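/- Let $K$ be the Klein bottle, the Cayley complex of $\mathcal P=\langle x,y\mid y^{-1}xyx\rangle$, so that $\pi_1(K)=\langle x,y\mid y^{-1}xyx\rangle$. Let $X_{\mathcal Q}$ be the Cayley complex (one vertex, one loop for each generator, one disk for each relator, relators read from right to left) of $$\mathcal Q=\langle x,y\mid y^{-2}xy^{2}x^{-1},\ x^{-3}(y^{-1}xy)x^{2}(y^{-1}x^{-2}y)\rangle .$$ The presentation $\mathcal Q$ presents the same group as $\mathcal P$ through $x\mapsto x$, $y\mapsto y$, so $\pi_1(X_{\mathcal Q})\cong\pi_1(K)$, and the cellular chains and the homology of the universal cover $\widetilde{X_{\mathcal Q}}$ are right modules over $S=\mathbb Z[\pi_1(K)]$, acting through covering translations. Then: 1. $S$ is isomorphic, through $x\mapsto x$, $y\mapsto y$, to the skew Laurent ring $\mathbb Z[x^{\pm1}][y^{\pm1};\sigma]$, in which $y^{-1}ry=\sigma(r)$ for $r\in\mathbb Z[x^{\pm1}]$, where $\sigma$ is the ring automorphism with $\sigma(x)=x^{-1}$. 2. The homomorphism of right $S$-modules $\psi\colon S^2\to S$, $\psi(u,v)=(y-x^{-1})u+(x^3-x-1)v$,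 is surjective. 3. If $D_1,D_2$ denote the lifts, based at the base vertex, of the disks of the first and the second relator, then there is an isomorphism of right $S$-modules $H_2(\widetilde{X_{\mathcal Q}})\cong\ker\psi$ under which a cycle $D_1u+D_2v$ corresponds to $(u,v)$. 4. $H_2(\widetilde{X_{\mathcal Q}})$ is not a free $S$-module. -/

import Mathlib

/-! ## Combinatorial 2-complexes -/

/-- A directed graph: the 1-skeleton of a combinatorial 2-complex. -/
structure OneSkeleton where
  /-- vertices (0-cells) -/
  Vert : Type
  /-- oriented edges (1-cells) -/
  Edge : Type
  /-- initial vertex of an edge -/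
  src : Edge → Vert
  /-- terminal vertex of an edge -/
  tgt : Edge → Vert

namespace OneSkeleton

variable (X : OneSkeleton)

/-- A step: an edge together with a direction of traversal (`true` is forwards, `false` is
backwards). -/
abbrev Step := X.Edge × Bool

/-- The vertex at which a step begins. -/
def start : X.Step → X.Vert
  | (e, true) => X.src e
  | (e, false) => X.tgt e

/-- The vertex at which a step ends. -/
def finish : X.Step → X.Vert
  | (e, true) => X.tgt e
  | (e, false) => X.src e

/-- `X.IsWalk u l v`: the steps of `l`, taken in order, form an edge path from `u` to `v`. -/
def IsWalk : X.Vert → List X.Step → X.Vert → Prop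
  | u, [], v => u = v
  | u, s :: l, v => X.start s = u ∧ IsWalk (X.finish s) l v

end OneSkeleton

/-- A combinatorial 2-complex: a 1-skeleton with 2-cells, each of them a disk whose boundary is
attached along a closed edge path. -/
structure TwoComplex extends OneSkeleton where
  /-- 2-cells -/
  Face : Type
  /-- the vertex at which the attaching path of a 2-cell begins and ends -/
  base : Face → Vert
  /-- the attaching path of a 2-cell -/
  bdry : Face → List toOneSkeleton.Step
  /-- attaching paths are closed edge paths -/
  closed : ∀ f, toOneSkeleton.IsWalk (base f) (bdry f) (base f)

namespace TwoComplex

/-- An elementary homotopy of edge paths: removal of a backtrack, or of the boundary of a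
2-cell. -/
inductive Elementary (X : TwoComplex) : List X.Step → List X.Step → Prop
  | backtrack (p q : List X.Step) (e : X.Edge) (b : Bool) :
      Elementary X (p ++ (e, b) :: (e, !b) :: q) (p ++ q)
  | face (p q : List X.Step) (f : X.Face) :
      Elementary X (p ++ (X.bdry f ++ q)) (p ++ q)

/-- Homotopy of edge paths from `u` to `v`, relative to the end points: the equivalence relation
generated by elementary homotopies between edge paths from `u` to `v`. -/
def Homotopic (X : TwoComplex) (u v : X.Vert) : List X.Step → List X.Step → Prop :=
  Relation.EqvGen fun l l' => X.IsWalk u l v ∧ X.IsWalk u l' v ∧ X.Elementary l l'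

/-- A 2-complex is simply connected if it is non-empty, connected, and every closed edge path is
homotopic to the constant one. -/
structure IsSimplyConnected (X : TwoComplex) : Prop where
  nonempty : Nonempty X.Vert
  connected : ∀ u v : X.Vert, ∃ l, X.IsWalk u l v
  contract : ∀ (u : X.Vert) (l : List X.Step), X.IsWalk u l u → X.Homotopic u u l []

/-- Cellular maps that send each cell to a cell, preserving orientations and attaching paths. -/
structure Hom (X Y : TwoComplex) where
  onVert : X.Vert → Y.Vert
  onEdge : X.Edge → Y.Edge
  onFace : X.Face → Y.Face
  src_eq : ∀ e, Y.src (onEdge e) = onVert (X.src e)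
  tgt_eq : ∀ e, Y.tgt (onEdge e) = onVert (X.tgt e)
  base_eq : ∀ f, Y.base (onFace f) = onVert (X.base f)
  bdry_eq : ∀ f, Y.bdry (onFace f) = (X.bdry f).map fun s => (onEdge s.1, s.2)

/-- A covering map of 2-complexes: it is surjective on vertices, and edges (at either end) and
2-cells lift uniquely once a lift of an end point (of the base vertex) is chosen. -/
structure Hom.IsCovering {X Y : TwoComplex} (p : Hom X Y) : Prop where
  surjective : Function.Surjective p.onVert
  lift_src : ∀ (v : X.Vert) (e : Y.Edge), Y.src e = p.onVert v →
    ∃! e' : X.Edge, X.src e' = v ∧ p.onEdge e' = e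
  lift_tgt : ∀ (v : X.Vert) (e : Y.Edge), Y.tgt e = p.onVert v →
    ∃! e' : X.Edge, X.tgt e' = v ∧ p.onEdge e' = e
  lift_face : ∀ (v : X.Vert) (f : Y.Face), Y.base f = p.onVert v →
    ∃! f' : X.Face, X.base f' = v ∧ p.onFace f' = f

/-- A universal cover of a 2-complex: a simply connected 2-complex with a covering map. -/
structure UniversalCover (Y : TwoComplex) where
  total : TwoComplex
  proj : Hom total Y
  isCovering : proj.IsCovering
  isSimplyConnected : total.IsSimplyConnected

/-! ### Cellular chains -/

/-- Cellular 1-chains. -/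
abbrev C₁ (X : TwoComplex) := X.Edge →₀ ℤ

/-- Cellular 2-chains. -/
abbrev C₂ (X : TwoComplex) := X.Face →₀ ℤ

/-- The 1-chain of a step: the edge, with the sign of the direction of traversal. -/
noncomputable def stepChain (X : TwoComplex) (s : X.Step) : X.C₁ :=
  Finsupp.single s.1 (if s.2 then 1 else -1)

/-- The cellular boundary map `d₂`: a 2-cell goes to the signed sum of the edges that its
attaching path traverses. -/
noncomputable def d₂ (X : TwoComplex) : X.C₂ →ₗ[ℤ] X.C₁ :=
  Finsupp.linearCombination ℤ fun f => ((X.bdry f).map X.stepChain).sum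

/-- The second cellular homology group of a 2-complex. There are no 3-cells, so it consists of
all the 2-cycles. -/
noncomputable def H₂ (X : TwoComplex) : Submodule ℤ X.C₂ := LinearMap.ker X.d₂

/-- The map on 2-chains induced by a cellular map. -/
noncomputable def Hom.mapC₂ {X Y : TwoComplex} (p : Hom X Y) : X.C₂ →ₗ[ℤ] Y.C₂ :=
  Finsupp.lmapDomain ℤ ℤ p.onFace

/-- The map on 1-chains induced by a cellular map. -/
noncomputable def Hom.mapC₁ {X Y : TwoComplex} (p : Hom X Y) : X.C₁ →ₗ[ℤ] Y.C₁ :=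
  Finsupp.lmapDomain ℤ ℤ p.onEdge

theorem Hom.d₂_mapC₂ {X Y : TwoComplex} (p : Hom X Y) (c : X.C₂) :
    Y.d₂ (p.mapC₂ c) = p.mapC₁ (X.d₂ c) := by
  have h : Y.d₂ ∘ₗ p.mapC₂ = p.mapC₁ ∘ₗ X.d₂ := by
    refine Finsupp.lhom_ext' fun f => LinearMap.ext_ring ?_
    have : (p.mapC₂ (Finsupp.single f 1) : Y.C₂) = Finsupp.single (p.onFace f) 1 := by
      simp [mapC₂]
    simp only [LinearMap.comp_apply, Finsupp.lsingle_apply, this]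
    simp only [d₂, Finsupp.linearCombination_single, one_smul, p.bdry_eq, map_list_sum,
      List.map_map]
    congr 1
    refine List.map_congr_left fun s _ => ?_
    simp [stepChain, mapC₁]
  exact LinearMap.congr_fun h c

theorem Hom.mapC₂_mem {X Y : TwoComplex} (p : Hom X Y) {c : X.C₂} (hc : c ∈ X.H₂) :
    p.mapC₂ c ∈ Y.H₂ := by
  have hc' : X.d₂ c = 0 := hc
  change Y.d₂ (p.mapC₂ c) = 0
  rw [p.d₂_mapC₂, hc', map_zero]

end TwoComplex

/-! ## Group presentations, their Cayley complexes and universal covers -/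

/-- A group presentation: generators and relators. A relator is a word in the generators and
their inverses, written from left to right; `(a, true)` stands for `a` and `(a, false)` for the
inverse of `a`, as in `FreeGroup`. -/
structure GroupPresentation where
  Gen : Type
  Rel : Type
  word : Rel → List (Gen × Bool)

namespace GroupPresentation

variable (P : GroupPresentation)

/-- The group presented by `P`. This is the fundamental group of the Cayley complex of `P`: edge
loops at the only vertex, modulo homotopy. -/
abbrev Group : Type := PresentedGroup (Set.range fun r => FreeGroup.mk (P.word r))

/-- The element of the presented group that a letter stands for. -/
def letter : P.Gen × Bool → P.Group
  | (a, true) => PresentedGroup.of a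
  | (a, false) => (PresentedGroup.of a)⁻¹

/-- The 1-skeleton of the Cayley complex: a wedge of loops, one for each generator. -/
abbrev roseSkeleton : OneSkeleton where
  Vert := Unit
  Edge := P.Gen
  src _ := ()
  tgt _ := ()

theorem rose_isWalk (l : List (P.Gen × Bool)) (u v : Unit) : P.roseSkeleton.IsWalk u l v := by
  induction l generalizing u with
  | nil => rfl
  | cons s l ih => exact ⟨rfl, ih _⟩

/-- The Cayley complex `X_P`: a wedge of loops indexed by the generators, with a disk attached for
each relator along the loops that the relator expresses, read from right to left. -/
abbrev cayleyComplex : TwoComplex where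
  toOneSkeleton := P.roseSkeleton
  Face := P.Rel
  base _ := ()
  bdry r := (P.word r).reverse
  closed _ := P.rose_isWalk _ _ _

/-- The 1-skeleton of the universal cover: the vertices are the homotopy classes of edge paths in
`X_P` that begin at its vertex, that is, the elements of the group (products are read from right to
left), and the edge labelled `a` at the vertex `g` goes from `g` to `a * g`. -/
abbrev coverSkeleton : OneSkeleton where
  Vert := P.Group
  Edge := P.Group × P.Gen
  src e := e.1
  tgt e := PresentedGroup.of e.2 * e.1

/-- The lift, beginning at the vertex `g`, of the edge path in `X_P` with the given letters. -/
def lift : P.Group → List (P.Gen × Bool) → List (P.coverSkeleton.Step)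
  | _, [] => []
  | g, (a, true) :: l => ((g, a), true) :: lift (PresentedGroup.of a * g) l
  | g, (a, false) :: l =>
      (((PresentedGroup.of a)⁻¹ * g, a), false) :: lift ((PresentedGroup.of a)⁻¹ * g) l

/-- The vertex at which the lift that begins at `g` ends. -/
def endpoint : P.Group → List (P.Gen × Bool) → P.Group
  | g, [] => g
  | g, s :: l => endpoint (P.letter s * g) l

variable {P}

theorem lift_isWalk (g : P.Group) (l : List (P.Gen × Bool)) :
    P.coverSkeleton.IsWalk g (P.lift g l) (P.endpoint g l) := by
  induction l generalizing g with
  | nil => rfl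
  | cons s l ih =>
    obtain ⟨a, b⟩ := s
    cases b
    · exact ⟨by simp [OneSkeleton.start], ih _⟩
    · exact ⟨rfl, ih _⟩

theorem lift_append (g : P.Group) (l m : List (P.Gen × Bool)) :
    P.lift g (l ++ m) = P.lift g l ++ P.lift (P.endpoint g l) m := by
  induction l generalizing g with
  | nil => rfl
  | cons s l ih =>
    obtain ⟨a, b⟩ := s
    cases b <;> simp [lift, endpoint, letter, ih]

theorem endpoint_append (g : P.Group) (l m : List (P.Gen × Bool)) :
    P.endpoint g (l ++ m) = P.endpoint (P.endpoint g l) m := by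
  induction l generalizing g with
  | nil => rfl
  | cons s l ih => simp [endpoint, ih]

theorem endpoint_reverse (g : P.Group) (l : List (P.Gen × Bool)) :
    P.endpoint g l.reverse = PresentedGroup.mk _ (FreeGroup.mk l) * g := by
  induction l generalizing g with
  | nil => simp [endpoint, ← FreeGroup.one_eq_mk]
  | cons s l ih =>
    have h : FreeGroup.mk (s :: l) = FreeGroup.mk [s] * FreeGroup.mk l := by
      simp [FreeGroup.mul_mk]
    have h' : PresentedGroup.mk (Set.range fun r => FreeGroup.mk (P.word r)) (FreeGroup.mk [s])
        = P.letter s := by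
      obtain ⟨a, b⟩ := s
      cases b
      · have : FreeGroup.mk [(a, false)] = (FreeGroup.of a)⁻¹ := rfl
        rw [this, map_inv]; rfl
      · rfl
    rw [List.reverse_cons, endpoint_append, ih, h, map_mul, h', mul_assoc]
    rfl

theorem mk_word (r : P.Rel) :
    PresentedGroup.mk (Set.range fun r => FreeGroup.mk (P.word r)) (FreeGroup.mk (P.word r)) = 1 :=
  (QuotientGroup.eq_one_iff _).2 (Subgroup.subset_normalClosure ⟨r, rfl⟩)

theorem endpoint_word (g : P.Group) (r : P.Rel) : P.endpoint g (P.word r).reverse = g := by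
  rw [endpoint_reverse, mk_word, one_mul]

theorem map_lift (g : P.Group) (l : List (P.Gen × Bool)) :
    (P.lift g l).map (fun s => (s.1.2, s.2)) = l := by
  induction l generalizing g with
  | nil => rfl
  | cons s l ih =>
    obtain ⟨a, b⟩ := s
    cases b <;> simp [lift, ih]

theorem lift_map {g h : P.Group} {l : List P.coverSkeleton.Step}
    (hl : P.coverSkeleton.IsWalk g l h) :
    P.lift g (l.map fun s => (s.1.2, s.2)) = l ∧
      P.endpoint g (l.map fun s => (s.1.2, s.2)) = h := by
  induction l generalizing g with
  | nil => exact ⟨rfl, hl⟩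
  | cons s l ih =>
    obtain ⟨⟨k, a⟩, b⟩ := s
    obtain ⟨h1, h2⟩ := hl
    cases b
    · simp only [OneSkeleton.start] at h1
      subst h1
      obtain ⟨h3, h4⟩ := ih h2
      simp only [OneSkeleton.finish] at h3 h4
      simp [lift, endpoint, letter, h3, h4]
    · simp only [OneSkeleton.start] at h1
      subst h1
      obtain ⟨h3, h4⟩ := ih h2
      simp only [OneSkeleton.finish] at h3 h4
      simp [lift, endpoint, letter, h3, h4]

theorem lift_mul (g h : P.Group) (l : List (P.Gen × Bool)) :
    P.lift (g * h) l = (P.lift g l).map fun s => ((s.1.1 * h, s.1.2), s.2) := by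
  induction l generalizing g with
  | nil => rfl
  | cons s l ih =>
    obtain ⟨a, b⟩ := s
    cases b <;> simp [lift, ← mul_assoc, ih]

variable (P)

/-- The universal cover of `X_P`: over the disk of each relator there is one disk for each vertex
`g`, attached along the lift of the attaching path that begins at `g`. -/
abbrev coverComplex : TwoComplex where
  toOneSkeleton := P.coverSkeleton
  Face := P.Group × P.Rel
  base f := f.1
  bdry f := P.lift f.1 (P.word f.2).reverse
  closed f := by
    have h := lift_isWalk f.1 (P.word f.2).reverse
    rwa [endpoint_word] at h

/-- The covering projection. -/
def coverProj : TwoComplex.Hom P.coverComplex P.cayleyComplex where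
  onVert _ := ()
  onEdge e := e.2
  onFace f := f.2
  src_eq _ := rfl
  tgt_eq _ := rfl
  base_eq _ := rfl
  bdry_eq f := (map_lift f.1 (P.word f.2).reverse).symm

theorem coverProj_isCovering : P.coverProj.IsCovering where
  surjective := fun _ => ⟨(1 : P.Group), rfl⟩
  lift_src v e _ := ⟨(v, e), ⟨rfl, rfl⟩, fun e' h => Prod.ext h.1 h.2⟩
  lift_tgt v e _ := by
    refine ⟨((PresentedGroup.of e)⁻¹ * v, e), ⟨by simp, rfl⟩, ?_⟩
    rintro ⟨k, a⟩ ⟨h1, h2⟩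
    have h2' : a = e := h2
    subst h2'
    have h1' : PresentedGroup.of a * k = v := h1
    subst h1'
    simp
  lift_face v f _ := ⟨(v, f), ⟨rfl, rfl⟩, fun f' h => Prod.ext h.1 h.2⟩

variable {P}

/-- Homotopic words (loops in the Cayley complex). -/
def WordHomotopic (l m : List (P.Gen × Bool)) : Prop := P.cayleyComplex.Homotopic () () l m

theorem WordHomotopic.refl (l : List (P.Gen × Bool)) : WordHomotopic l l := Relation.EqvGen.refl l

theorem WordHomotopic.symm {l m : List (P.Gen × Bool)} (h : WordHomotopic l m) :
    WordHomotopic m l := Relation.EqvGen.symm _ _ h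

theorem WordHomotopic.trans {l m n : List (P.Gen × Bool)} (h : WordHomotopic l m)
    (h' : WordHomotopic m n) : WordHomotopic l n := Relation.EqvGen.trans _ _ _ h h'

theorem WordHomotopic.of {l m : List (P.Gen × Bool)} (h : P.cayleyComplex.Elementary l m) :
    WordHomotopic l m :=
  Relation.EqvGen.rel _ _ ⟨P.rose_isWalk _ _ _, P.rose_isWalk _ _ _, h⟩

theorem WordHomotopic.congr {l m : List (P.Gen × Bool)} (h : WordHomotopic l m)
    (p q : List (P.Gen × Bool)) : WordHomotopic (p ++ (l ++ q)) (p ++ (m ++ q)) := by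
  unfold WordHomotopic TwoComplex.Homotopic at h
  induction h with
  | rel l m h =>
    obtain ⟨-, -, h'⟩ := h
    rcases h' with ⟨p', q', e, b⟩ | ⟨p', q', f⟩
    · have := TwoComplex.Elementary.backtrack (X := P.cayleyComplex) (p ++ p') (q' ++ q) e b
      exact WordHomotopic.of (by simpa using this)
    · have := TwoComplex.Elementary.face (X := P.cayleyComplex) (p ++ p') (q' ++ q) f
      exact WordHomotopic.of (by simpa using this)
  | refl => exact .refl _
  | symm _ _ _ ih => exact ih.symm
  | trans _ _ _ _ _ ih1 ih2 => exact ih1.trans ih2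

theorem WordHomotopic.cancel (w : List (P.Gen × Bool)) :
    WordHomotopic (w ++ FreeGroup.invRev w) [] := by
  induction w with
  | nil => exact .refl _
  | cons s w ih =>
    obtain ⟨a, b⟩ := s
    have h1 := ih.congr [(a, b)] [(a, !b)]
    have h2 : WordHomotopic [(a, b), (a, !b)] ([] : List (P.Gen × Bool)) :=
      .of (TwoComplex.Elementary.backtrack (X := P.cayleyComplex) [] [] a b)
    refine .trans ?_ h2
    have h3 : (a, b) :: w ++ FreeGroup.invRev ((a, b) :: w)
        = [(a, b)] ++ ((w ++ FreeGroup.invRev w) ++ [(a, !b)]) := by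
      simp [FreeGroup.invRev]
    rw [h3]
    exact h1

theorem WordHomotopic.of_red {l m : List (P.Gen × Bool)} (h : FreeGroup.Red l m) :
    WordHomotopic l.reverse m.reverse := by
  induction h with
  | refl => exact .refl _
  | tail _ h ih =>
    refine .trans ih ?_
    cases h with
    | @not p q x b =>
      have := TwoComplex.Elementary.backtrack (X := P.cayleyComplex) q.reverse p.reverse x (!b)
      exact WordHomotopic.of (by simpa using this)

theorem WordHomotopic.of_mk_eq {l m : List (P.Gen × Bool)}
    (h : FreeGroup.mk l = FreeGroup.mk m) : WordHomotopic l.reverse m.reverse := by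
  obtain ⟨c, h1, h2⟩ := FreeGroup.Red.exact.1 h
  exact .trans (.of_red h1) (.symm (.of_red h2))

/-- The elements of the free group represented by words (read backwards) that are null-homotopic
in the Cayley complex. -/
def nullSubgroup (P : GroupPresentation) : Subgroup (FreeGroup P.Gen) where
  carrier := {z | ∃ w, FreeGroup.mk w = z ∧ WordHomotopic w.reverse ([] : List (P.Gen × Bool))}
  one_mem' := ⟨[], rfl, .refl _⟩
  mul_mem' := by
    rintro _ _ ⟨v, rfl, hv⟩ ⟨w, rfl, hw⟩
    refine ⟨v ++ w, rfl, ?_⟩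
    rw [List.reverse_append]
    refine .trans (m := w.reverse) ?_ hw
    have h := hv.congr w.reverse []
    simp only [List.append_nil] at h
    exact h
  inv_mem' := by
    rintro _ ⟨w, rfl, hw⟩
    refine ⟨FreeGroup.invRev w, rfl, ?_⟩
    have e : (FreeGroup.invRev w).reverse = FreeGroup.invRev w.reverse := by
      simp [FreeGroup.invRev]
    rw [e]
    have h1 : WordHomotopic (w.reverse ++ FreeGroup.invRev w.reverse)
        (FreeGroup.invRev w.reverse) := by
      simpa using hw.congr [] (FreeGroup.invRev w.reverse)
    exact .trans (.symm h1) (.cancel _)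

instance nullSubgroup_normal : P.nullSubgroup.Normal where
  conj_mem := by
    rintro _ ⟨w, rfl, hw⟩ g
    obtain ⟨v, rfl⟩ : ∃ v, FreeGroup.mk v = g := Quot.exists_rep g
    refine ⟨v ++ w ++ FreeGroup.invRev v, rfl, ?_⟩
    rw [List.reverse_append, List.reverse_append]
    have h1 := hw.congr (FreeGroup.invRev v).reverse v.reverse
    refine .trans h1 ?_
    rw [List.nil_append]
    have e : v.reverse = FreeGroup.invRev (FreeGroup.invRev v).reverse := by
      simp [FreeGroup.invRev, Function.comp_def]
    rw [e]
    exact .cancel _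

theorem wordHomotopic_of_mk_eq_one {l : List (P.Gen × Bool)}
    (h : PresentedGroup.mk (Set.range fun r => FreeGroup.mk (P.word r)) (FreeGroup.mk l) = 1) :
    WordHomotopic l.reverse [] := by
  have h1 : FreeGroup.mk l ∈ P.nullSubgroup := by
    refine Subgroup.normalClosure_le_normal ?_ ((QuotientGroup.eq_one_iff _).1 h)
    rintro _ ⟨r, rfl⟩
    refine ⟨P.word r, rfl, ?_⟩
    have := TwoComplex.Elementary.face (X := P.cayleyComplex) [] [] r
    exact WordHomotopic.of (by simpa using this)
  obtain ⟨w, hw, hw'⟩ := h1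
  exact .trans (.of_mk_eq hw.symm) hw'

theorem lift_backtrack (g : P.Group) (p q : List (P.Gen × Bool)) (e : P.Gen) (b : Bool) :
    P.endpoint g (p ++ (e, b) :: (e, !b) :: q) = P.endpoint g (p ++ q) ∧
      P.coverComplex.Elementary (P.lift g (p ++ (e, b) :: (e, !b) :: q)) (P.lift g (p ++ q)) := by
  cases b
  · have := TwoComplex.Elementary.backtrack (X := P.coverComplex) (P.lift g p)
      (P.lift (P.endpoint g p) q) ((PresentedGroup.of e)⁻¹ * P.endpoint g p, e) false
    simpa [lift_append, endpoint_append, endpoint, letter, lift] using this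
  · have := TwoComplex.Elementary.backtrack (X := P.coverComplex) (P.lift g p)
      (P.lift (P.endpoint g p) q) (P.endpoint g p, e) true
    simpa [lift_append, endpoint_append, endpoint, letter, lift] using this

theorem lift_face (g : P.Group) (p q : List (P.Gen × Bool)) (r : P.Rel) :
    P.endpoint g (p ++ ((P.word r).reverse ++ q)) = P.endpoint g (p ++ q) ∧
      P.coverComplex.Elementary (P.lift g (p ++ ((P.word r).reverse ++ q)))
        (P.lift g (p ++ q)) := by
  have := TwoComplex.Elementary.face (X := P.coverComplex) (P.lift g p)
    (P.lift (P.endpoint g p) q) (P.endpoint g p, r)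
  simpa [lift_append, endpoint_append, endpoint_word] using this

theorem lift_homotopic (g : P.Group) {l m : List (P.Gen × Bool)} (h : WordHomotopic l m) :
    P.endpoint g l = P.endpoint g m ∧
      P.coverComplex.Homotopic g (P.endpoint g l) (P.lift g l) (P.lift g m) := by
  unfold WordHomotopic TwoComplex.Homotopic at h
  induction h with
  | rel l m h =>
    have key : P.endpoint g l = P.endpoint g m ∧
        P.coverComplex.Elementary (P.lift g l) (P.lift g m) := by
      obtain ⟨-, -, h'⟩ := h
      rcases h' with ⟨p, q, e, b⟩ | ⟨p, q, r⟩
      · exact lift_backtrack g p q e b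
      · exact lift_face g p q r
    refine ⟨key.1, .rel _ _ ⟨lift_isWalk g l, ?_, key.2⟩⟩
    rw [key.1]
    exact lift_isWalk g m
  | refl => exact ⟨rfl, .refl _⟩
  | symm _ _ _ ih => exact ⟨ih.1.symm, ih.1 ▸ .symm _ _ ih.2⟩
  | trans _ _ _ _ _ ih1 ih2 => exact ⟨ih1.1.trans ih2.1, .trans _ _ _ ih1.2 (ih1.1 ▸ ih2.2)⟩

/-- The presented group is the fundamental group of the Cayley complex: two words, read from right
to left as edge loops, are homotopic if and only if they represent the same element. -/
theorem wordHomotopic_iff (l m : List (P.Gen × Bool)) :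
    WordHomotopic l.reverse m.reverse ↔
      PresentedGroup.mk (Set.range fun r => FreeGroup.mk (P.word r)) (FreeGroup.mk l) =
        PresentedGroup.mk (Set.range fun r => FreeGroup.mk (P.word r)) (FreeGroup.mk m) := by
  constructor
  · intro h
    have h1 := (lift_homotopic (1 : P.Group) h).1
    rwa [endpoint_reverse, endpoint_reverse, mul_one, mul_one] at h1
  · intro h
    have h1 : PresentedGroup.mk (Set.range fun r => FreeGroup.mk (P.word r))
        (FreeGroup.mk (l ++ FreeGroup.invRev m)) = 1 := by
      rw [← FreeGroup.mul_mk, ← FreeGroup.inv_mk, map_mul, map_inv, h, mul_inv_cancel]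
    have h2 := (wordHomotopic_of_mk_eq_one h1).congr m.reverse []
    have e : (FreeGroup.invRev m).reverse = FreeGroup.invRev m.reverse := by
      simp [FreeGroup.invRev]
    have h3 := (WordHomotopic.cancel m.reverse).congr [] l.reverse
    rw [List.reverse_append, e] at h2
    simp only [List.append_nil, List.nil_append, List.append_assoc] at h2 h3
    exact h3.symm.trans h2

theorem coverComplex_isSimplyConnected (P : GroupPresentation) :
    P.coverComplex.IsSimplyConnected where
  nonempty := ⟨(1 : P.Group)⟩
  connected u v := by
    obtain ⟨z, hz⟩ := PresentedGroup.mk_surjective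
      (Set.range fun r => FreeGroup.mk (P.word r)) (v * u⁻¹)
    obtain ⟨w, rfl⟩ : ∃ w, FreeGroup.mk w = z := Quot.exists_rep z
    refine ⟨P.lift u w.reverse, ?_⟩
    have h := lift_isWalk u w.reverse
    rw [endpoint_reverse, hz] at h
    simpa using h
  contract u l hl := by
    obtain ⟨h1, h2⟩ := lift_map hl
    set w := (l.map fun s => (s.1.2, s.2)).reverse with hw
    have hw' : (l.map fun s => (s.1.2, s.2)) = w.reverse := by simp [hw]
    rw [hw'] at h1 h2
    rw [endpoint_reverse] at h2
    have h3 := wordHomotopic_of_mk_eq_one (mul_eq_right.1 h2)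
    have h4 := lift_homotopic u h3
    rw [h1] at h4
    have h5 := h4.2
    rw [h4.1] at h5
    exact h5

/-- The universal cover of the Cayley complex of a presentation. -/
abbrev universalCover (P : GroupPresentation) : TwoComplex.UniversalCover P.cayleyComplex where
  total := P.coverComplex
  proj := P.coverProj
  isCovering := P.coverProj_isCovering
  isSimplyConnected := P.coverComplex_isSimplyConnected

/-! ### The second homology of the universal cover as a right module over the group ring -/

/-- The covering translation by `g`. On vertices it is right multiplication by `g`: the homotopy
class of an edge path is precomposed with the loop `g`. -/
def deck (P : GroupPresentation) (g : P.Group) :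
    TwoComplex.Hom P.universalCover.total P.universalCover.total where
  onVert (k : P.Group) := (k * g : P.Group)
  onEdge (e : P.Group × P.Gen) := ((e.1 * g, e.2) : P.Group × P.Gen)
  onFace (f : P.Group × P.Rel) := ((f.1 * g, f.2) : P.Group × P.Rel)
  src_eq _ := rfl
  tgt_eq e := (mul_assoc (PresentedGroup.of e.2 : P.Group) e.1 g).symm
  base_eq _ := rfl
  bdry_eq f := lift_mul f.1 g (P.word f.2).reverse

/-- Covering translations lie over the identity of the Cayley complex. -/
theorem proj_deck (P : GroupPresentation) (g : P.Group) :
    P.universalCover.proj.onVert ∘ (P.deck g).onVert = P.universalCover.proj.onVert ∧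
    P.universalCover.proj.onEdge ∘ (P.deck g).onEdge = P.universalCover.proj.onEdge ∧
    P.universalCover.proj.onFace ∘ (P.deck g).onFace = P.universalCover.proj.onFace :=
  ⟨rfl, rfl, rfl⟩

/-- The right action of the group on cellular 2-chains of the universal cover, by covering
translations. -/
noncomputable def translate (P : GroupPresentation) :
    P.Group →* (Module.End ℤ P.universalCover.total.C₂)ᵐᵒᵖ where
  toFun g := MulOpposite.op (P.deck g).mapC₂
  map_one' := by
    refine congrArg MulOpposite.op (Finsupp.lhom_ext fun f n => ?_)
    refine (Finsupp.mapDomain_single (f := (P.deck 1).onFace) (a := f) (b := n)).trans ?_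
    exact congrArg (fun k => Finsupp.single (k, f.2) n) (mul_one f.1)
  map_mul' g h := by
    refine congrArg MulOpposite.op (Finsupp.lhom_ext fun f n => ?_)
    refine (Finsupp.mapDomain_single (f := (P.deck (g * h)).onFace) (a := f) (b := n)).trans ?_
    refine Eq.trans ?_ (congrArg (P.deck h).mapC₂
      (Finsupp.mapDomain_single (f := (P.deck g).onFace) (a := f) (b := n))).symm
    refine Eq.trans ?_ (Finsupp.mapDomain_single (f := (P.deck h).onFace)
      (a := (P.deck g).onFace f) (b := n)).symm
    exact congrArg (fun k => Finsupp.single (k, f.2) n) (mul_assoc f.1 g h).symm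

/-- The right action of the integral group ring on cellular 2-chains of the universal cover,
extending that of the group linearly. -/
noncomputable def rightAction (P : GroupPresentation) :
    (MonoidAlgebra ℤ P.Group)ᵐᵒᵖ →ₐ[ℤ] Module.End ℤ P.universalCover.total.C₂ :=
  AlgHom.opComm (MonoidAlgebra.lift ℤ _ P.Group P.translate)

/-- Cellular 2-chains of the universal cover form a right module over the group ring, that is, a
module over its opposite ring. -/
noncomputable instance chainModule (P : GroupPresentation) :
    Module (MonoidAlgebra ℤ P.Group)ᵐᵒᵖ P.universalCover.total.C₂ :=
  Module.compHom _ P.rightAction.toRingHom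

theorem op_single_smul (P : GroupPresentation) (g : P.Group) (n : ℤ)
    (c : P.universalCover.total.C₂) :
    MulOpposite.op (MonoidAlgebra.single g n) • c = n • (P.deck g).mapC₂ c := by
  change (MulOpposite.unop (MonoidAlgebra.lift ℤ _ P.Group P.translate
    (MonoidAlgebra.single g n))) c = _
  rw [MonoidAlgebra.lift_single]
  rfl

/-- The second homology of the universal cover, as a right module over the group ring. -/
noncomputable def H₂ (P : GroupPresentation) :
    Submodule (MonoidAlgebra ℤ P.Group)ᵐᵒᵖ P.universalCover.total.C₂ where
  carrier := P.universalCover.total.H₂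
  add_mem' := P.universalCover.total.H₂.add_mem
  zero_mem' := P.universalCover.total.H₂.zero_mem
  smul_mem' a c hc := by
    obtain ⟨a, rfl⟩ := MulOpposite.op_surjective a
    induction a using MonoidAlgebra.induction_linear with
    | zero => simp
    | add a b ha hb =>
      rw [MulOpposite.op_add, add_smul]
      exact P.universalCover.total.H₂.add_mem ha hb
    | single g n =>
      rw [op_single_smul]
      exact P.universalCover.total.H₂.smul_mem n ((P.deck g).mapC₂_mem hc)

end GroupPresentation

/-! ## The Klein bottle group and the presentation `Q` -/

namespace FakeKlein

/-- The two generators. -/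
inductive Letter
  | x
  | y

open Letter

/-- The presentation `P = ⟨x, y | y⁻¹ x y x⟩`. Its Cayley complex is the Klein bottle `K`. -/
def P : GroupPresentation where
  Gen := Letter
  Rel := Unit
  word _ := [(y, false), (x, true), (y, true), (x, true)]

/-- The presentation
`Q = ⟨x, y | y⁻² x y² x⁻¹, x⁻³ (y⁻¹ x y) x² (y⁻¹ x⁻² y)⟩`. -/
def Q : GroupPresentation where
  Gen := Letter
  Rel := Fin 2
  word := ![[(y, false), (y, false), (x, true), (y, true), (y, true), (x, false)],
    [(x, false), (x, false), (x, false), (y, false), (x, true), (y, true), (x, true), (x, true),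
      (y, false), (x, false), (x, false), (y, true)]]

/-- The generator `x` of the fundamental group of the Klein bottle. -/
def gx : P.Group := PresentedGroup.of x

/-- The generator `y` of the fundamental group of the Klein bottle. -/
def gy : P.Group := PresentedGroup.of y

/-- The element `x` of the group presented by `Q`. -/
def qx : Q.Group := PresentedGroup.of x

/-- The element `y` of the group presented by `Q`. -/
def qy : Q.Group := PresentedGroup.of y

theorem rel_P : gy⁻¹ * gx * gy * gx = 1 := by
  have h := GroupPresentation.mk_word (P := P) ()
  have e : FreeGroup.mk (P.word ()) = (FreeGroup.of y)⁻¹ * FreeGroup.of x * FreeGroup.of y *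
    FreeGroup.of x := rfl
  rw [e] at h
  exact h

theorem rel_Q₁ : qy⁻¹ * qy⁻¹ * qx * qy * qy * qx⁻¹ = 1 := by
  have h := GroupPresentation.mk_word (P := Q) (0 : Fin 2)
  have e : FreeGroup.mk (Q.word (0 : Fin 2)) = (FreeGroup.of y)⁻¹ * (FreeGroup.of y)⁻¹ *
    FreeGroup.of x * FreeGroup.of y * FreeGroup.of y * (FreeGroup.of x)⁻¹ := rfl
  rw [e] at h
  exact h

theorem rel_Q₂ : qx⁻¹ * qx⁻¹ * qx⁻¹ * qy⁻¹ * qx * qy * qx * qx * qy⁻¹ * qx⁻¹ * qx⁻¹ * qy = 1 := by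
  have h := GroupPresentation.mk_word (P := Q) (1 : Fin 2)
  have e : FreeGroup.mk (Q.word (1 : Fin 2)) = (FreeGroup.of x)⁻¹ * (FreeGroup.of x)⁻¹ *
    (FreeGroup.of x)⁻¹ * (FreeGroup.of y)⁻¹ * FreeGroup.of x * FreeGroup.of y * FreeGroup.of x *
    FreeGroup.of x * (FreeGroup.of y)⁻¹ * (FreeGroup.of x)⁻¹ * (FreeGroup.of x)⁻¹ *
    FreeGroup.of y := rfl
  rw [e] at h
  exact h

/-- In any group, the two relations of `Q` imply the relation of `P`. -/
theorem rel_of_rels {G : Type*} [_root_.Group G] {x y : G} (h₁ : y⁻¹ * y⁻¹ * x * y * y * x⁻¹ = 1)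
    (h₂ : x⁻¹ * x⁻¹ * x⁻¹ * y⁻¹ * x * y * x * x * y⁻¹ * x⁻¹ * x⁻¹ * y = 1) :
    y⁻¹ * x * y * x = 1 := by
  obtain ⟨a, ha⟩ : ∃ a, a = y⁻¹ * x * y := ⟨_, rfl⟩
  have hb : y⁻¹ * a * y = x := by
    rw [ha]
    have := mul_inv_eq_one.1 h₁
    simpa [mul_assoc] using this
  have e1 : a * (x * x) = x * x * x * (a * a) := by
    have h3 : a * (x * x) * (a * a)⁻¹ = x * x * x := by
      have h4 : (x * x * x)⁻¹ * (a * (x * x) * (a * a)⁻¹) = 1 := by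
        rw [ha, ← h₂]; group
      exact (inv_mul_eq_one.1 h4).symm
    rw [← h3]; group
  have e2 : x * (a * a) = a * a * a * (x * x) := by
    have h5 := congrArg (fun t => y⁻¹ * t * y) e1
    have l : y⁻¹ * (a * (x * x)) * y = (y⁻¹ * a * y) * ((y⁻¹ * x * y) * (y⁻¹ * x * y)) := by group
    have r : y⁻¹ * (x * x * x * (a * a)) * y = (y⁻¹ * x * y) * (y⁻¹ * x * y) * (y⁻¹ * x * y) *
      ((y⁻¹ * a * y) * (y⁻¹ * a * y)) := by group
    simp only [l, r, hb, ← ha] at h5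
    exact h5
  have e3 : a * a * (x * x) = 1 := by
    have h6 : (a * a * (x * x)) * (x * (a * a)) = x * (a * a) := by
      calc (a * a * (x * x)) * (x * (a * a)) = a * a * (x * x * x * (a * a)) := by group
        _ = a * a * (a * (x * x)) := by rw [e1]
        _ = a * a * a * (x * x) := by group
        _ = x * (a * a) := e2.symm
    exact mul_eq_right.1 h6
  have e4 : x * (a * a) = a := by
    rw [e2]
    calc a * a * a * (x * x) = a * (a * a * (x * x)) := by group
      _ = a := by rw [e3, mul_one]
  have e5 : x * a = 1 := by
    have : x * a * a = a := by rw [mul_assoc, e4]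
    exact mul_eq_right.1 this
  rw [← ha]
  exact mul_eq_one_comm.1 e5

/-- In any group, the relation of `P` implies the first relation of `Q`. -/
theorem rel₁_of_rel {G : Type*} [_root_.Group G] {x y : G} (h : y⁻¹ * x * y * x = 1) :
    y⁻¹ * y⁻¹ * x * y * y * x⁻¹ = 1 := by
  have h1 : y⁻¹ * x * y = x⁻¹ := eq_inv_of_mul_eq_one_left h
  have h2 : y⁻¹ * x⁻¹ * y = x := by
    have h3 : y⁻¹ * x⁻¹ * y = (y⁻¹ * x * y)⁻¹ := by group
    rw [h3, h1, inv_inv]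
  calc y⁻¹ * y⁻¹ * x * y * y * x⁻¹ = y⁻¹ * (y⁻¹ * x * y) * y * x⁻¹ := by group
    _ = 1 := by rw [h1, h2, mul_inv_cancel]

/-- In any group, the relation of `P` implies the second relation of `Q`. -/
theorem rel₂_of_rel {G : Type*} [_root_.Group G] {x y : G} (h : y⁻¹ * x * y * x = 1) :
    x⁻¹ * x⁻¹ * x⁻¹ * y⁻¹ * x * y * x * x * y⁻¹ * x⁻¹ * x⁻¹ * y = 1 := by
  have h1 : y⁻¹ * x * y = x⁻¹ := eq_inv_of_mul_eq_one_left h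
  have h2 : y⁻¹ * x⁻¹ * y = x := by
    have h3 : y⁻¹ * x⁻¹ * y = (y⁻¹ * x * y)⁻¹ := by group
    rw [h3, h1, inv_inv]
  calc x⁻¹ * x⁻¹ * x⁻¹ * y⁻¹ * x * y * x * x * y⁻¹ * x⁻¹ * x⁻¹ * y
      = x⁻¹ * x⁻¹ * x⁻¹ * (y⁻¹ * x * y) * x * x * (y⁻¹ * x⁻¹ * y) * (y⁻¹ * x⁻¹ * y) := by group
    _ = 1 := by rw [h1, h2]; group

/-- The values of the generators under the homomorphism from the group of `P` to that of `Q`. -/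
def valQ : P.Gen → Q.Group := fun a : Letter => PresentedGroup.of (α := Q.Gen) a

/-- The values of the generators under the homomorphism from the group of `Q` to that of `P`. -/
def valP : Q.Gen → P.Group := fun a : Letter => PresentedGroup.of (α := P.Gen) a

theorem valQ_rel : ∀ r ∈ Set.range fun r => FreeGroup.mk (P.word r), FreeGroup.lift valQ r = 1 := by
  rintro _ ⟨r, rfl⟩
  have h (v : Letter → Q.Group) : FreeGroup.lift v ((FreeGroup.of y)⁻¹ * FreeGroup.of x *
      FreeGroup.of y * FreeGroup.of x) = (v y)⁻¹ * v x * v y * v x := by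
    simp only [map_mul, map_inv, FreeGroup.lift_apply_of]
  exact (h valQ).trans (rel_of_rels rel_Q₁ rel_Q₂)

theorem valP_rel : ∀ r ∈ Set.range fun r => FreeGroup.mk (Q.word r), FreeGroup.lift valP r = 1 := by
  rintro _ ⟨r, rfl⟩
  change Fin 2 at r
  fin_cases r
  · have h (v : Letter → P.Group) : FreeGroup.lift v ((FreeGroup.of y)⁻¹ * (FreeGroup.of y)⁻¹ *
        FreeGroup.of x * FreeGroup.of y * FreeGroup.of y * (FreeGroup.of x)⁻¹) =
        (v y)⁻¹ * (v y)⁻¹ * v x * v y * v y * (v x)⁻¹ := by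
      simp only [map_mul, map_inv, FreeGroup.lift_apply_of]
    exact (h valP).trans (rel₁_of_rel rel_P)
  · have h (v : Letter → P.Group) : FreeGroup.lift v ((FreeGroup.of x)⁻¹ * (FreeGroup.of x)⁻¹ *
        (FreeGroup.of x)⁻¹ * (FreeGroup.of y)⁻¹ * FreeGroup.of x * FreeGroup.of y * FreeGroup.of x *
        FreeGroup.of x * (FreeGroup.of y)⁻¹ * (FreeGroup.of x)⁻¹ * (FreeGroup.of x)⁻¹ *
        FreeGroup.of y) = (v x)⁻¹ * (v x)⁻¹ * (v x)⁻¹ * (v y)⁻¹ * v x * v y * v x * v x * (v y)⁻¹ *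
        (v x)⁻¹ * (v x)⁻¹ * v y := by
      simp only [map_mul, map_inv, FreeGroup.lift_apply_of]
    exact (h valP).trans (rel₂_of_rel rel_P)

/-- `P` and `Q` present the same group: the identification sends `x` to `x` and `y` to `y`. -/
def groupEquiv : P.Group ≃* Q.Group :=
  MonoidHom.toMulEquiv (PresentedGroup.toGroup valQ_rel) (PresentedGroup.toGroup valP_rel)
    (PresentedGroup.ext fun a =>
      (congrArg (PresentedGroup.toGroup valP_rel)
        (PresentedGroup.toGroup.of valQ_rel (x := a))).trans (PresentedGroup.toGroup.of valP_rel))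
    (PresentedGroup.ext fun a =>
      (congrArg (PresentedGroup.toGroup valQ_rel)
        (PresentedGroup.toGroup.of valP_rel (x := a))).trans (PresentedGroup.toGroup.of valQ_rel))

theorem groupEquiv_gx : groupEquiv gx = qx := PresentedGroup.toGroup.of valQ_rel

theorem groupEquiv_gy : groupEquiv gy = qy := PresentedGroup.toGroup.of valQ_rel

/-- The integral group ring of the fundamental group of the Klein bottle `K`. -/
abbrev ZK := MonoidAlgebra ℤ P.Group

/-- The element of the group ring given by an element of the fundamental group. -/
noncomputable abbrev el (g : P.Group) : ZK := MonoidAlgebra.single g 1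

/-- The universal cover of `X_Q`. -/
abbrev cover : TwoComplex.UniversalCover Q.cayleyComplex := Q.universalCover

/-- The group rings of the two presented groups, identified. -/
noncomputable def ringEquiv : ZK ≃+* MonoidAlgebra ℤ Q.Group :=
  (MonoidAlgebra.domCongr ℤ ℤ groupEquiv).toRingEquiv

/-- The cellular 2-chains of the universal cover of `X_Q`, as a right module over the group ring of
the fundamental group of the Klein bottle. -/
noncomputable instance chainModuleZK : Module ZKᵐᵒᵖ cover.total.C₂ :=
  letI : Module (MonoidAlgebra ℤ Q.Group)ᵐᵒᵖ cover.total.C₂ := Q.chainModule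
  Module.compHom _ (RingHom.op ringEquiv.toRingHom)

/-- The second homology of the universal cover of `X_Q`, as a right module over the group ring of
the fundamental group of the Klein bottle. -/
noncomputable def H₂ : Submodule ZKᵐᵒᵖ cover.total.C₂ where
  carrier := cover.total.H₂
  add_mem' := cover.total.H₂.add_mem
  zero_mem' := cover.total.H₂.zero_mem
  smul_mem' a _ hc := Q.H₂.smul_mem (RingHom.op ringEquiv.toRingHom a) hc

/-- The first relator of `Q`. -/
def rel₁ : Q.Rel := (0 : Fin 2)

/-- The second relator of `Q`. -/
def rel₂ : Q.Rel := (1 : Fin 2)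

/-- The 2-cell of the universal cover of `X_Q` over the disk of a relator, at the base vertex. -/
noncomputable def cell (r : Q.Rel) : cover.total.C₂ := Finsupp.single (1, r) 1

/-- The homomorphism `(u, v) ↦ (y - x⁻¹) u + (x³ - x - 1) v` of right modules. -/
noncomputable def psi : (ZK × ZK) →ₗ[ZKᵐᵒᵖ] ZK where
  toFun w := (el gy - el gx⁻¹) * w.1 + (el gx ^ 3 - el gx - 1) * w.2
  map_add' w w' := by simp only [Prod.fst_add, Prod.snd_add, mul_add]; abel
  map_smul' a w := by
    simp only [Prod.smul_fst, Prod.smul_snd, MulOpposite.smul_eq_mul_unop, RingHom.id_apply,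
      add_mul, mul_assoc]

/-! ### The skew Laurent ring -/

open scoped LaurentPolynomial

/-- The infinite cyclic group generated by `y`. -/
def Powers : Type := Multiplicative ℤ

instance : CommGroup Powers := inferInstanceAs (CommGroup (Multiplicative ℤ))

/-- The generator of the infinite cyclic group. -/
def Powers.gen : Powers := Multiplicative.ofAdd 1

/-- The automorphism `σ` of `ℤ[x, x⁻¹]` with `σ x = x⁻¹`. -/
noncomputable def sigma : RingAut ℤ[T;T⁻¹] := LaurentPolynomial.invert.toRingEquiv

/-- The generator of the infinite cyclic group acts on `ℤ[x, x⁻¹]` by `σ`. -/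
noncomputable instance : MulSemiringAction Powers ℤ[T;T⁻¹] :=
  MulSemiringAction.compHom ℤ[T;T⁻¹] (zpowersHom (RingAut ℤ[T;T⁻¹]) sigma : Powers →* _)

/-- The skew Laurent ring `ℤ[x, x⁻¹][y, y⁻¹; σ]`: finite sums of terms `r yⁿ`, where
`y r = σ(r) y`; as `σ` is an involution, this is the same as `y⁻¹ r y = σ(r)`. -/
abbrev SkewLaurent := SkewMonoidAlgebra ℤ[T;T⁻¹] Powers

/-- The element `x` of the skew Laurent ring. -/
noncomputable def SkewLaurent.x : SkewLaurent :=
  SkewMonoidAlgebra.single 1 (LaurentPolynomial.T 1)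

/-- The element `y` of the skew Laurent ring. -/
noncomputable def SkewLaurent.y : SkewLaurent := SkewMonoidAlgebra.single Powers.gen 1

end FakeKlein

/-! ### The group ring of the Klein bottle group as a skew Laurent ring -/

namespace FakeKlein

open scoped LaurentPolynomial
open Letter LaurentPolynomial

/-! Write σ for inversion of x and c = x³ - x - 1. The relation of the Klein bottle group reads xy =
yx⁻¹, which is exactly the commutation rule of the skew Laurent ring. The universal properties of
the two rings give mutually inverse maps, and all the algebra is then done with Laurent polynomials
in y over ℤ[x, x⁻¹].

Surjectivity of ψ: since cy = yσ(c), the image of ψ contains cy - (y - x⁻¹)σ(c) = x⁻¹σ(c) as well as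
c. These two Laurent polynomials in x are coprime (`bezout_cubic`), so 1 is in the image.

Homology: the cellular boundary of the cover of X_Q factors as ψ followed by multiplication by the
column (1 + yx, x - 1) of Fox derivatives of the relator of P, that is, by the boundary map of the
universal cover of K (`d₂_chainMap`). Left multiplication by x - 1 is injective, so the 2-cycles are
exactly the kernel of ψ.

Non-freeness: ψ splits, so ker ψ ⊕ S ≅ S². The augmentation makes ranks well defined, and a free
kernel would have a single generator (w₁, w₂) (`exists_generator_ker_of_free`). Then w₂ would divide
on the left the second coordinate of every syzygy, in particular y² - 1 and yc - x⁻¹σ(c). Let the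
width of an element be its top minus its bottom degree in y; widths add under multiplication. Hence
w₂ has width 0 or 1. Width 0 is incompatible with cw₂ = -(y - x⁻¹)w₁. In width 1 the cofactor of yc
- x⁻¹σ(c) is a monomial in y. Its coefficient, up to a twist, divides both c and x⁻¹σ(c), so it is a
unit. The top coefficient of w₂ is a unit too, because that of y² - 1 is 1. So c would be a unit,
which it is not (`not_principal`). -/

theorem gx_mul_gy : gx * gy = gy * gx⁻¹ := by
  have h : gy⁻¹ * gx * gy = gx⁻¹ := eq_inv_of_mul_eq_one_left rel_P
  rw [← h]; group

theorem Powers.eq_gen_zpow (g : Powers) : ∃ n : ℤ, g = Powers.gen ^ n := by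
  refine ⟨Multiplicative.toAdd g, ?_⟩
  have h := ofAdd_zsmul (Multiplicative.toAdd g) (1 : ℤ)
  rw [smul_eq_mul, mul_one] at h
  exact h

theorem gen_smul (r : ℤ[T;T⁻¹]) : Powers.gen • r = LaurentPolynomial.invert r := by
  change (zpowersHom (RingAut ℤ[T;T⁻¹]) sigma (Multiplicative.ofAdd 1)) r = _
  simp [zpowersHom, sigma]

theorem invert_invert (r : ℤ[T;T⁻¹]) :
    LaurentPolynomial.invert (LaurentPolynomial.invert r) = r :=
  involutive_invert r

namespace SkewLaurent

/-- `x` as a unit of the skew Laurent ring. -/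
noncomputable def xUnit : SkewLaurentˣ where
  val := x
  inv := SkewMonoidAlgebra.single 1 (T (-1))
  val_inv := by
    rw [x, SkewMonoidAlgebra.single_mul_single, one_smul, ← T_add, add_neg_cancel, T_zero, one_mul,
      SkewMonoidAlgebra.single_one_one]
  inv_val := by
    rw [x, SkewMonoidAlgebra.single_mul_single, one_smul, ← T_add, neg_add_cancel, T_zero, one_mul,
      SkewMonoidAlgebra.single_one_one]

/-- `y` as a unit of the skew Laurent ring. -/
noncomputable def yUnit : SkewLaurentˣ where
  val := y
  inv := SkewMonoidAlgebra.single Powers.gen⁻¹ 1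
  val_inv := by simp [y, SkewMonoidAlgebra.single_mul_single]
  inv_val := by simp [y, SkewMonoidAlgebra.single_mul_single]

theorem xUnit_mul_yUnit : xUnit * yUnit = yUnit * xUnit⁻¹ := by
  ext1
  change x * y = y * SkewMonoidAlgebra.single 1 (T (-1))
  simp [x, y, SkewMonoidAlgebra.single_mul_single, gen_smul]

theorem single_one_T (n : ℤ) :
    (SkewMonoidAlgebra.single 1 (T n) : SkewLaurent) = ((xUnit ^ n : SkewLaurentˣ) : SkewLaurent)
      := by
  induction n with
  | zero => simp
  | succ n ih =>
    rw [zpow_add_one, Units.val_mul, ← ih]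
    change _ = _ * x
    rw [x, SkewMonoidAlgebra.single_mul_single, one_smul, ← T_add, one_mul]
  | pred n ih =>
    rw [zpow_sub_one, Units.val_mul, ← ih]
    change _ = _ * SkewMonoidAlgebra.single 1 (T (-1))
    rw [SkewMonoidAlgebra.single_mul_single, one_smul, ← T_add, one_mul, sub_eq_add_neg]

theorem single_gen_zpow (n : ℤ) :
    (SkewMonoidAlgebra.single (Powers.gen ^ n) 1 : SkewLaurent) =
      ((yUnit ^ n : SkewLaurentˣ) : SkewLaurent) := by
  induction n with
  | zero => simp
  | succ n ih =>
    rw [zpow_add_one, zpow_add_one, Units.val_mul, ← ih]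
    change _ = _ * y
    simp [y, SkewMonoidAlgebra.single_mul_single]
  | pred n ih =>
    rw [zpow_sub_one, zpow_sub_one, Units.val_mul, ← ih]
    change _ = _ * SkewMonoidAlgebra.single Powers.gen⁻¹ 1
    simp [SkewMonoidAlgebra.single_mul_single]

end SkewLaurent

/-- The values of the generators in the unit group of the skew Laurent ring. -/
noncomputable def unitOf : P.Gen → SkewLaurentˣ
  | Letter.x => SkewLaurent.xUnit
  | Letter.y => SkewLaurent.yUnit

theorem unitOf_rel :
    ∀ r ∈ Set.range fun r => FreeGroup.mk (P.word r), FreeGroup.lift unitOf r = 1 := by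
  rintro _ ⟨r, rfl⟩
  have h (v : Letter → SkewLaurentˣ) : FreeGroup.lift v ((FreeGroup.of y)⁻¹ * FreeGroup.of x *
      FreeGroup.of y * FreeGroup.of x) = (v y)⁻¹ * v x * v y * v x := by
    simp only [map_mul, map_inv, FreeGroup.lift_apply_of]
  refine (h unitOf).trans ?_
  change SkewLaurent.yUnit⁻¹ * SkewLaurent.xUnit * SkewLaurent.yUnit * SkewLaurent.xUnit = 1
  rw [mul_assoc _ SkewLaurent.xUnit, SkewLaurent.xUnit_mul_yUnit]
  group

/-- The homomorphism from the Klein bottle group to the units of the skew Laurent ring. -/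
noncomputable def groupToUnits : P.Group →* SkewLaurentˣ := PresentedGroup.toGroup unitOf_rel

theorem groupToUnits_gx : groupToUnits gx = SkewLaurent.xUnit := PresentedGroup.toGroup.of
  unitOf_rel

theorem groupToUnits_gy : groupToUnits gy = SkewLaurent.yUnit := PresentedGroup.toGroup.of
  unitOf_rel

/-- The homomorphism from the group ring to the skew Laurent ring. -/
noncomputable def toSkew : ZK →ₐ[ℤ] SkewLaurent :=
  MonoidAlgebra.lift ℤ SkewLaurent P.Group ((Units.coeHom SkewLaurent).comp groupToUnits)

theorem toSkew_el (g : P.Group) : toSkew (el g) = (groupToUnits g : SkewLaurentˣ) := by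
  rw [toSkew, MonoidAlgebra.lift_single, Algebra.smul_def, map_one, one_mul]; rfl

/-- The inclusion of the Laurent polynomials in `x` in the group ring. -/
noncomputable def ofLaurent : ℤ[T;T⁻¹] →ₐ[ℤ] ZK :=
  AddMonoidAlgebra.lift ℤ ZK ℤ ((MonoidAlgebra.of ℤ P.Group).comp (zpowersHom _ gx))

theorem ofLaurent_T (n : ℤ) : ofLaurent (T n) = el (gx ^ n) := by
  rw [ofLaurent, T, AddMonoidAlgebra.lift_single, one_smul]
  simp [el]

/-- The powers of `y` in the group ring. -/
noncomputable def ofPowers : Powers →* ZK :=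
  (MonoidAlgebra.of ℤ P.Group).comp (zpowersHom _ gy : Multiplicative ℤ →* P.Group)

theorem ofPowers_gen : ofPowers Powers.gen = el gy := by
  change MonoidAlgebra.of ℤ P.Group (zpowersHom _ gy (Multiplicative.ofAdd 1)) = _
  simp [el]

theorem gx_zpow_mul_gy (n : ℤ) : gx ^ n * gy = gy * gx ^ (-n) := by
  have h : gx = gy * gx⁻¹ * gy⁻¹ := by rw [← gx_mul_gy]; group
  have h2 : gx ^ n = gy * (gx⁻¹) ^ n * gy⁻¹ := by
    conv_lhs => rw [h]
    exact conj_zpow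
  rw [h2]; group

/-- Additivity reduces the claim to monomials, where it is the group relation xⁿy = yx⁻ⁿ. -/
theorem ofLaurent_invert_mul_el_gy (r : ℤ[T;T⁻¹]) :
    ofLaurent (LaurentPolynomial.invert r) * el gy = el gy * ofLaurent r := by
  induction r using LaurentPolynomial.induction_on' with
  | add p q hp hq => simp only [map_add, add_mul, mul_add, hp, hq]
  | C_mul_T n a =>
    have h : (C a * T n : ℤ[T;T⁻¹]) = a • T n := by rw [smul_eq_C_mul]
    rw [h, map_zsmul, map_zsmul, map_zsmul, invert_T, ofLaurent_T, ofLaurent_T, smul_mul_assoc,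
      mul_smul_comm]
    simp only [el, MonoidAlgebra.single_mul_single, gx_zpow_mul_gy, neg_neg]

/-- This is the compatibility that allows coefficients and powers of y to be combined into a ring
homomorphism on the skew ring. The case of y gives that of y⁻¹ by conjugation, and both propagate to
all powers by induction. -/
theorem ofLaurent_smul_mul_ofPowers (g : Powers) (r : ℤ[T;T⁻¹]) :
    ofLaurent (g • r) * ofPowers g = ofPowers g * ofLaurent r := by
  obtain ⟨n, rfl⟩ := g.eq_gen_zpow
  have hgen (r : ℤ[T;T⁻¹]) : ofLaurent (Powers.gen • r) * ofPowers Powers.gen =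
      ofPowers Powers.gen * ofLaurent r := by
    rw [gen_smul, ofPowers_gen, ofLaurent_invert_mul_el_gy]
  have hinv : ofPowers Powers.gen * ofPowers Powers.gen⁻¹ = 1 := by
    rw [← map_mul, mul_inv_cancel, map_one]
  have hinv' : ofPowers Powers.gen⁻¹ * ofPowers Powers.gen = 1 := by
    rw [← map_mul, inv_mul_cancel, map_one]
  have hgeninv (r : ℤ[T;T⁻¹]) : ofLaurent (Powers.gen⁻¹ • r) * ofPowers Powers.gen⁻¹ =
      ofPowers Powers.gen⁻¹ * ofLaurent r := by
    have h := hgen (Powers.gen⁻¹ • r)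
    rw [smul_inv_smul] at h
    calc _ = ofPowers Powers.gen⁻¹ * (ofPowers Powers.gen * ofLaurent (Powers.gen⁻¹ • r)) *
          ofPowers Powers.gen⁻¹ := by rw [← mul_assoc, hinv', one_mul]
      _ = _ := by rw [← h, mul_assoc, mul_assoc, hinv, mul_one]
  induction n generalizing r with
  | zero => simp
  | succ n ih =>
    rw [zpow_add_one, mul_smul, map_mul, ← mul_assoc, ih, mul_assoc, hgen, mul_assoc]
  | pred n ih =>
    rw [zpow_sub_one, mul_smul, map_mul, ← mul_assoc, ih, mul_assoc, hgeninv, mul_assoc]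

/-- The homomorphism from the skew Laurent ring to the group ring. -/
noncomputable def ofSkew : SkewLaurent →+* ZK :=
  SkewMonoidAlgebra.liftNCRingHom (ofLaurent : ℤ[T;T⁻¹] →+* ZK) ofPowers
    fun {r g} => ofLaurent_smul_mul_ofPowers g r

theorem ofSkew_single (g : Powers) (r : ℤ[T;T⁻¹]) :
    ofSkew (SkewMonoidAlgebra.single g r) = ofLaurent r * ofPowers g :=
  SkewMonoidAlgebra.liftNC_single _ _ _ _

theorem ofSkew_x : ofSkew SkewLaurent.x = el gx := by
  rw [SkewLaurent.x, ofSkew_single, ofLaurent_T, map_one, mul_one, zpow_one]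

theorem ofSkew_y : ofSkew SkewLaurent.y = el gy := by
  rw [SkewLaurent.y, ofSkew_single, map_one, one_mul, ofPowers_gen]

theorem ofSkew_toSkew (a : ZK) : ofSkew (toSkew a) = a := by
  -- Two homomorphisms out of a presented group agree once they agree on the generators; the
  -- integers in the group ring are then automatic.
  have h : ((Units.map (ofSkew : SkewLaurent →* ZK)).comp groupToUnits) =
      (MonoidAlgebra.of ℤ P.Group).toHomUnits := by
    refine PresentedGroup.ext fun l => Units.ext ?_
    change ofSkew (groupToUnits (PresentedGroup.of l) : SkewLaurentˣ) = el (PresentedGroup.of l)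
    cases l
    · exact (congrArg (fun u : SkewLaurentˣ => ofSkew u) groupToUnits_gx).trans ofSkew_x
    · exact (congrArg (fun u : SkewLaurentˣ => ofSkew u) groupToUnits_gy).trans ofSkew_y
  have h2 : ofSkew.comp (toSkew : ZK →+* SkewLaurent) = RingHom.id ZK := by
    refine MonoidAlgebra.ringHom_ext (fun n => ?_) fun g => ?_
    · have : (MonoidAlgebra.single 1 n : ZK) = ((n : ℤ) : ZK) := by
        simp [MonoidAlgebra.intCast_def]
      rw [this, map_intCast, map_intCast]
    · exact (congrArg ofSkew (toSkew_el g)).trans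
        (congrArg Units.val (DFunLike.congr_fun h g))
  exact DFunLike.congr_fun h2 a

theorem toSkew_ofLaurent (r : ℤ[T;T⁻¹]) :
    toSkew (ofLaurent r) = SkewMonoidAlgebra.single 1 r := by
  induction r using LaurentPolynomial.induction_on' with
  | add p q hp hq => rw [map_add, map_add, hp, hq, SkewMonoidAlgebra.single_add]
  | C_mul_T n a =>
    have h : (C a * T n : ℤ[T;T⁻¹]) = a • T n := by rw [smul_eq_C_mul]
    rw [h, map_zsmul, map_zsmul, ofLaurent_T, toSkew_el, map_zpow, groupToUnits_gx,
      ← SkewLaurent.single_one_T]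
    exact (map_zsmul (SkewMonoidAlgebra.singleAddHom 1 : ℤ[T;T⁻¹] →+ SkewLaurent) a (T n)).symm

theorem toSkew_ofPowers (g : Powers) :
    toSkew (ofPowers g) = SkewMonoidAlgebra.single g 1 := by
  obtain ⟨n, rfl⟩ := g.eq_gen_zpow
  have : ofPowers (Powers.gen ^ n) = el (gy ^ n) := by
    change MonoidAlgebra.of ℤ P.Group
      (zpowersHom P.Group gy ((Multiplicative.ofAdd (1 : ℤ)) ^ n)) = _
    simp [el]
  rw [this, toSkew_el, map_zpow, groupToUnits_gy, SkewLaurent.single_gen_zpow]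

theorem toSkew_ofSkew (a : SkewLaurent) : toSkew (ofSkew a) = a := by
  induction a using SkewMonoidAlgebra.induction_on with
  | zero => rw [map_zero, map_zero]
  | single g r =>
    rw [ofSkew_single, map_mul, toSkew_ofLaurent, toSkew_ofPowers,
      SkewMonoidAlgebra.single_mul_single]
    simp
  | add a b ha hb => rw [map_add, map_add, ha, hb]

/-- The group ring of the Klein bottle group is the skew Laurent ring. -/
noncomputable def skewEquiv : ZK ≃+* SkewLaurent :=
  { (toSkew : ZK →+* SkewLaurent) with
    invFun := ofSkew
    left_inv := ofSkew_toSkew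
    right_inv := toSkew_ofSkew }

theorem skewEquiv_el_gx : skewEquiv (el gx) = SkewLaurent.x :=
  (toSkew_el gx).trans (congrArg Units.val groupToUnits_gx)

theorem skewEquiv_el_gy : skewEquiv (el gy) = SkewLaurent.y :=
  (toSkew_el gy).trans (congrArg Units.val groupToUnits_gy)

theorem skewEquiv_el_gx_inv : skewEquiv (el gx⁻¹) = SkewMonoidAlgebra.single 1 (T (-1)) :=
  (toSkew_el gx⁻¹).trans (congrArg Units.val ((map_inv _ _).trans
    (congrArg Inv.inv groupToUnits_gx)))

end FakeKlein

/-! ### Leading terms in skew group rings -/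

namespace SkewMonoidAlgebra

variable {k G : Type*} [Ring k]

/-- `g` is the leading position of `a` with respect to the degree function `φ`. -/
def IsLead (φ : G → ℤ) (a : SkewMonoidAlgebra k G) (g : G) : Prop :=
  a.coeff g ≠ 0 ∧ ∀ h, a.coeff h ≠ 0 → φ h ≤ φ g

theorem exists_isLead (φ : G → ℤ) {a : SkewMonoidAlgebra k G} (ha : a ≠ 0) :
    ∃ g, IsLead φ a g := by
  have hne : a.support.Nonempty := by
    rw [Finset.nonempty_iff_ne_empty, Ne, support_eq_empty]
    exact ha
  obtain ⟨g, hg, hmax⟩ := a.support.exists_max_image φ hne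
  exact ⟨g, mem_support_iff.1 hg, fun h hh => hmax h (mem_support_iff.2 hh)⟩

theorem IsLead.unique {φ : G → ℤ} (hφ : Function.Injective φ) {a : SkewMonoidAlgebra k G} {g h : G}
    (hg : IsLead φ a g) (hh : IsLead φ a h) : g = h :=
  hφ (le_antisymm (hh.2 g hg.1) (hg.2 h hh.1))

theorem IsLead.ne_zero {φ : G → ℤ} {a : SkewMonoidAlgebra k G} {g : G}
    (hg : IsLead φ a g) : a ≠ 0 := by
  rintro rfl
  exact hg.1 rfl

theorem isLead_single (φ : G → ℤ) (g : G) {r : k} (hr : r ≠ 0) : IsLead φ (single g r) g := by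
  classical
  refine ⟨by simpa [coeff_single_apply] using hr, fun h hh => ?_⟩
  by_cases e : g = h
  · rw [e]
  · simp [e] at hh

theorem isLead_single_sub_single {φ : G → ℤ} {g h : G} (hlt : φ h < φ g) {r s : k} (hr : r ≠ 0) :
    IsLead φ (single g r - single h s) g := by
  classical
  have hne : h ≠ g := fun e => by simp [e] at hlt
  refine ⟨by simpa [coeff_single_apply, hne] using hr, fun l hl => ?_⟩
  by_cases e : g = l
  · rw [e]
  · by_cases e' : h = l
    · rw [← e']; exact hlt.le
    · simp [e, e'] at hl

variable [Group G] [MulSemiringAction G k]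

/-- Degrees add and separate group elements, so (g, h) is the only pair of positions in the two
supports with product gh: any other first factor would force a degree above a leading one. -/
theorem IsLead.coeff_mul {φ : G → ℤ} (hφ : Function.Injective φ)
    (hmul : ∀ g h, φ (g * h) = φ g + φ h) {a b : SkewMonoidAlgebra k G} {g h : G}
    (hg : IsLead φ a g) (hh : IsLead φ b h) :
    (a * b).coeff (g * h) = a.coeff g * g • b.coeff h := by
  classical
  rw [SkewMonoidAlgebra.coeff_mul, sum_def', Finset.sum_eq_single g, sum_def',
    Finset.sum_eq_single h, if_pos rfl]
  · intro h' _ hne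
    rw [if_neg fun e => hne (mul_left_cancel e)]
  · intro hn
    exact absurd (mem_support_iff.2 hh.1) hn
  · intro g' hg' hne
    rw [sum_def']
    refine Finset.sum_eq_zero fun h' hh' => if_neg fun e => hne (hφ ?_)
    have e' := congrArg φ e
    rw [hmul, hmul] at e'
    have h1 := hg.2 g' (mem_support_iff.1 hg')
    have h2 := hh.2 h' (mem_support_iff.1 hh')
    omega
  · intro hn
    exact absurd (mem_support_iff.2 hg.1) hn

/-- The product of leading coefficients, one of them twisted by an automorphism, does not vanish in
a domain. Used with the degree and with its negative, this controls both top and bottom terms. -/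
theorem IsLead.mul [NoZeroDivisors k] {φ : G → ℤ} (hφ : Function.Injective φ)
    (hmul : ∀ g h, φ (g * h) = φ g + φ h) {a b : SkewMonoidAlgebra k G} {g h : G}
    (hg : IsLead φ a g) (hh : IsLead φ b h) : IsLead φ (a * b) (g * h) := by
  classical
  refine ⟨?_, fun l hl => ?_⟩
  · rw [hg.coeff_mul hφ hmul hh]
    exact mul_ne_zero hg.1 ((smul_ne_zero_iff_ne g).2 hh.1)
  · obtain ⟨g', hg', h', hh', rfl⟩ := Finset.mem_mul.1 (support_mul a b (mem_support_iff.2 hl))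
    have h1 := hg.2 g' (mem_support_iff.1 hg')
    have h2 := hh.2 h' (mem_support_iff.1 hh')
    rw [hmul, hmul]
    omega

end SkewMonoidAlgebra

/-! ### The row (y - x⁻¹, x³ - x - 1): coprimality, syzygies, and no single generator -/

namespace FakeKlein

open scoped LaurentPolynomial
open LaurentPolynomial SkewMonoidAlgebra

/-- The Laurent polynomial `x³ - x - 1`. -/
noncomputable def cubic : ℤ[T;T⁻¹] := T 1 ^ 3 - T 1 - 1

/-- The product of `x⁻¹` and the image of `x³ - x - 1` under `σ`. -/
noncomputable def cubicTwist : ℤ[T;T⁻¹] := T (-1) * LaurentPolynomial.invert cubic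

theorem T_one_mul_T_neg_one : (T 1 * T (-1) : ℤ[T;T⁻¹]) = 1 := by
  rw [← T_add, add_neg_cancel, T_zero]

/-- Multiplied by x⁴, the twist x⁻¹σ(c) = x⁻⁴ - x⁻² - x⁻¹ becomes 1 - x² - x³; times x - 1 this is
-x⁴ + x² + x - 1 = -xc - 1. -/
theorem bezout_cubic :
    cubic * -T 1 - cubicTwist * ((T 1 - 1) * T 1 ^ 4) = 1 := by
  have h := T_one_mul_T_neg_one
  simp only [cubicTwist, cubic, map_sub, map_pow, map_one, invert_T]
  generalize (T 1 : ℤ[T;T⁻¹]) = X at *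
  generalize (T (-1) : ℤ[T;T⁻¹]) = Y at *
  have h1 : X ^ 4 * Y = X ^ 3 := by linear_combination X ^ 3 * h
  have h2 : X ^ 4 * Y ^ 2 = X ^ 2 := by linear_combination Y * h1 + X ^ 2 * h
  have h4 : X ^ 4 * Y ^ 4 = 1 := by rw [← mul_pow, h, one_pow]
  linear_combination -(X - 1) * (h4 - h2 - h1)

theorem isCoprime_cubic : IsCoprime cubic cubicTwist :=
  ⟨-T 1, -((T 1 - 1) * T 1 ^ 4), by linear_combination bezout_cubic⟩

/-- Modulo 5 the cubic has the root 2, since 8 - 2 - 1 = 5. As 2 is invertible there, evaluation at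
2 is defined on Laurent polynomials and sends the cubic to 0. -/
theorem not_isUnit_cubic : ¬ IsUnit cubic := by
  intro h
  have h2 : (2 : ZMod 5) * 3 = 1 := by decide
  let u : (ZMod 5)ˣ := ⟨2, 3, h2, by decide⟩
  have h3 := h.map (eval₂ (Int.castRingHom (ZMod 5)) u)
  have h4 : eval₂ (Int.castRingHom (ZMod 5)) u cubic = 0 := by
    simp only [cubic, map_sub, map_pow, map_one, eval₂_T, zpow_one]
    change (2 : ZMod 5) ^ 3 - 2 - 1 = 0
    decide
  rw [h4] at h3
  exact (by decide : (0 : ZMod 5) ≠ 1) (isUnit_zero_iff.1 h3)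

theorem cubic_ne_zero : cubic ≠ 0 := by
  intro h
  -- The value at x = 1 is -1.
  have h3 := congrArg (eval₂ (Int.castRingHom ℤ) (1 : ℤˣ)) h
  simp [cubic, eval₂_T] at h3

theorem invert_cubic_ne_zero : LaurentPolynomial.invert cubic ≠ 0 :=
  (map_ne_zero_iff _ LaurentPolynomial.invert.injective).2 cubic_ne_zero

theorem cubicTwist_ne_zero : cubicTwist ≠ 0 :=
  mul_ne_zero (isUnit_T (-1)).ne_zero invert_cubic_ne_zero

namespace SkewLaurent

/-- The inclusion of the coefficient ring. -/
noncomputable abbrev coe (r : ℤ[T;T⁻¹]) : SkewLaurent := single 1 r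

theorem single_one_mul_y (r : ℤ[T;T⁻¹]) : coe r * y = y * coe (LaurentPolynomial.invert r) := by
  rw [coe, coe, y, single_mul_single, single_mul_single, gen_smul, invert_invert]
  simp

/-- The right linear map `(u, v) ↦ (y - x⁻¹) u + (x³ - x - 1) v`. -/
noncomputable def row (u v : SkewLaurent) : SkewLaurent :=
  (y - coe (T (-1))) * u + coe cubic * v

theorem coe_mul (r s : ℤ[T;T⁻¹]) : coe (r * s) = coe r * coe s := by
  simp [coe, single_mul_single]

theorem coe_sub (r s : ℤ[T;T⁻¹]) : coe (r - s) = coe r - coe s := by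
  simp only [coe, sub_eq_add_neg, single_add, single_neg]

theorem row_mul (u v s : SkewLaurent) : row (u * s) (v * s) = row u v * s := by
  simp only [row, add_mul, mul_assoc]

theorem coe_neg_mul_eq_of_add_eq_zero {a w : SkewLaurent} {r : ℤ[T;T⁻¹]}
    (h : a + coe r * w = 0) : coe (-r) * w = a := by
  have key {A : Type} [Ring A] (a c w : A) (h : a + c * w = 0) : -c * w = a := by
    rw [neg_mul, eq_neg_of_add_eq_zero_left h]
  rw [coe, single_neg]
  exact key _ _ _ h

/-- Moving y to the left of c turns it into yσ(c), and the terms in y cancel. This puts the twist in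
the right ideal generated by the row. -/
theorem coe_cubicTwist_eq : coe cubicTwist =
    coe cubic * y - (y - coe (T (-1))) * coe (LaurentPolynomial.invert cubic) := by
  rw [single_one_mul_y, cubicTwist, coe_mul, sub_mul, sub_sub_cancel]

theorem exists_row_eq_one : ∃ u v, row u v = 1 := by
  -- The coefficients come from substituting the expression of `coe_cubicTwist_eq` for the twist in
  -- the Bézout identity and collecting the factors of y - x⁻¹ and of c.
  refine ⟨coe (LaurentPolynomial.invert cubic) * coe ((T 1 - 1) * T 1 ^ 4),
    coe (-T 1) - y * coe ((T 1 - 1) * T 1 ^ 4), ?_⟩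
  have h := congrArg coe bezout_cubic
  rw [coe_sub, coe_mul, coe_mul cubicTwist, coe_cubicTwist_eq] at h
  refine Eq.trans ?_ h
  have key {A : Type} [Ring A] (y t s q c b : A) :
      (y - t) * (s * q) + c * (b - y * q) = c * b - (c * y - (y - t) * s) * q := by
    noncomm_ring
  exact key _ _ _ _ _ _

/-- From cy = yσ(c) and c · x⁻¹σ(c) = x⁻¹ · σ(c)c, the product c(yc - x⁻¹σ(c)) equals (y -
x⁻¹)σ(c)c. -/
theorem row_linear_syzygy :
    row (-(coe (LaurentPolynomial.invert cubic * cubic)))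
      (y * coe cubic - coe cubicTwist) = 0 := by
  have h : coe cubic * coe cubicTwist =
      coe (T (-1)) * coe (LaurentPolynomial.invert cubic * cubic) := by
    rw [← coe_mul, ← coe_mul, cubicTwist]
    congr 1
    ring
  rw [row, mul_sub, h, ← mul_assoc, single_one_mul_y, mul_assoc, ← coe_mul]
  have key {A : Type} [Ring A] (y t p : A) : (y - t) * -p + (y * p - t * p) = 0 := by
    noncomm_ring
  exact key _ _ _

/-- Because yx = x⁻¹y, there is a factorization (y - x⁻¹)(y + x) = y² - 1, and y² commutes with c
since σ is an involution. -/
theorem row_quadratic_syzygy : row (-((y + x) * coe cubic)) (y * y - 1) = 0 := by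
  have h1 : coe cubic * (y * y) = y * y * coe cubic := by
    rw [← mul_assoc, single_one_mul_y, mul_assoc, single_one_mul_y, invert_invert, mul_assoc]
  have h2 : y * x = coe (T (-1)) * y := by
    rw [single_one_mul_y, invert_T, neg_neg]; rfl
  have h3 : coe (T (-1)) * x = 1 := by
    rw [x, ← coe, ← coe_mul, ← T_add, neg_add_cancel, T_zero, coe, single_one_one]
  have h4 : (y - coe (T (-1))) * (y + x) = y * y - 1 := by
    rw [sub_mul, mul_add, mul_add, h2, h3]
    abel
  have key {A : Type} [Ring A] (p q c : A) (h : c * q = q * c) (p' : A) (h' : p * p' = q - 1) :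
      p * -(p' * c) + c * (q - 1) = 0 := by
    rw [mul_neg, ← mul_assoc, h', mul_sub, h]
    noncomm_ring
  exact key _ _ _ h1 _ h4

/-- The degree in `y`. -/
def deg (g : Powers) : ℤ := Multiplicative.toAdd g

theorem deg_injective : Function.Injective deg := Multiplicative.toAdd.injective

theorem deg_mul (g h : Powers) : deg (g * h) = deg g + deg h := rfl

theorem deg_gen : deg Powers.gen = 1 := rfl

theorem deg_one : deg 1 = 0 := rfl

theorem neg_deg_injective : Function.Injective fun g => -deg g :=
  neg_injective.comp deg_injective

theorem neg_deg_mul (g h : Powers) : -deg (g * h) = -deg g + -deg h := by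
  rw [deg_mul]; ring

/-- The kernel of the row is not generated by one element. -/
theorem not_principal (w₁ w₂ : SkewLaurent) (hw : row w₁ w₂ = 0)
    (hgen : ∀ u v, row u v = 0 → ∃ s, v = w₂ * s) : False := by
  -- Only second coordinates matter: w₂s = y² - 1, and w₂c is the element yc - x⁻¹σ(c) of width 1,
  -- where the name `c` now denotes the cofactor rather than the cubic.
  obtain ⟨s, hs⟩ := hgen _ _ row_quadratic_syzygy
  obtain ⟨c, hc⟩ := hgen _ _ row_linear_syzygy
  have hquad : y * y - 1 = single (Powers.gen * Powers.gen) (1 : ℤ[T;T⁻¹]) - single 1 1 := by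
    simp [y, single_mul_single]
  have hlin : y * coe cubic - coe cubicTwist =
      single Powers.gen (LaurentPolynomial.invert cubic) - single 1 cubicTwist := by
    simp [y, coe, single_mul_single, gen_smul]
  have hlin' : single Powers.gen (LaurentPolynomial.invert cubic) - single 1 cubicTwist =
      single 1 (-cubicTwist) - single Powers.gen (-LaurentPolynomial.invert cubic) := by
    rw [single_neg, single_neg]; abel
  have hy : y - coe (T (-1)) = single Powers.gen 1 - single 1 (T (-1)) := rfl
  have hy' : y - coe (T (-1)) = single 1 (-T (-1)) - single Powers.gen (-1) := by
    rw [hy, single_neg, single_neg]; abel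
  have top_quad : IsLead deg (y * y - 1) (Powers.gen * Powers.gen) := by
    rw [hquad]
    exact isLead_single_sub_single (by decide) one_ne_zero
  have top_lin : IsLead deg (y * coe cubic - coe cubicTwist) Powers.gen := by
    rw [hlin]
    exact isLead_single_sub_single (by decide) invert_cubic_ne_zero
  have bot_lin : IsLead (fun g => -deg g) (y * coe cubic - coe cubicTwist) 1 := by
    rw [hlin, hlin']
    exact isLead_single_sub_single (by decide) (neg_ne_zero.2 cubicTwist_ne_zero)
  have top_y : IsLead deg (y - coe (T (-1))) Powers.gen := by
    rw [hy]
    exact isLead_single_sub_single (by decide) one_ne_zero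
  have bot_y : IsLead (fun g => -deg g) (y - coe (T (-1))) 1 := by
    rw [hy']
    exact isLead_single_sub_single (by decide) (neg_ne_zero.2 (isUnit_T (-1)).ne_zero)
  have hw₂ : w₂ ≠ 0 := fun h => top_lin.ne_zero (by rw [hc, h, zero_mul])
  have hs0 : s ≠ 0 := fun h => top_quad.ne_zero (by rw [hs, h, mul_zero])
  have hc0 : c ≠ 0 := fun h => top_lin.ne_zero (by rw [hc, h, mul_zero])
  obtain ⟨g, hg⟩ := exists_isLead deg hw₂
  obtain ⟨g', hg'⟩ := exists_isLead (fun g => -deg g) hw₂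
  obtain ⟨h, hh⟩ := exists_isLead deg hc0
  obtain ⟨h', hh'⟩ := exists_isLead (fun g => -deg g) hc0
  have e1 : g * h = Powers.gen :=
    (hc ▸ hg.mul deg_injective deg_mul hh).unique deg_injective top_lin
  have e2 : g' * h' = 1 :=
    (hc ▸ hg'.mul neg_deg_injective neg_deg_mul hh').unique neg_deg_injective bot_lin
  have hgg : deg g' ≤ deg g := hg.2 g' hg'.1
  have hhh : deg h' ≤ deg h := hh.2 h' hh'.1
  have d1 : deg g + deg h = 1 := congrArg deg e1
  have d2 : deg g' + deg h' = 0 := congrArg deg e2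
  -- The widths of w₂ and of its cofactor are nonnegative integers with sum 1.
  have hcase : deg g = deg g' ∨ deg h = deg h' := by omega
  rcases hcase with hcase | hcase
  -- If w₂ has width 0, so has the left side, while the factor y - x⁻¹ gives the right side width at
  -- least 1.
  · have hrow : coe (-cubic) * w₂ = (y - coe (T (-1))) * w₁ := by
      rw [row] at hw
      exact coe_neg_mul_eq_of_add_eq_zero hw
    have hF (φ : Powers → ℤ) : IsLead φ (coe (-cubic)) 1 :=
      isLead_single φ 1 (neg_ne_zero.2 cubic_ne_zero)
    have tl := (hF deg).mul deg_injective deg_mul hg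
    have bl := (hF fun g => -deg g).mul neg_deg_injective neg_deg_mul hg'
    rw [hrow] at tl bl
    have hw₁ : w₁ ≠ 0 := fun h => tl.ne_zero (by rw [h, mul_zero])
    obtain ⟨l, hl⟩ := exists_isLead deg hw₁
    obtain ⟨l', hl'⟩ := exists_isLead (fun g => -deg g) hw₁
    have f1 := congrArg deg ((top_y.mul deg_injective deg_mul hl).unique deg_injective tl)
    have f2 := congrArg deg
      ((bot_y.mul neg_deg_injective neg_deg_mul hl').unique neg_deg_injective bl)
    have hll : deg l' ≤ deg l := hl.2 l' hl'.1
    simp only [deg_mul, deg_gen, deg_one] at f1 f2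
    omega
  · obtain rfl : h = h' := deg_injective hcase
    -- Here the cofactor is a monomial of degree h, so the top and bottom degrees of w₂ differ by
    -- exactly one.
    have hgg' : g = Powers.gen * g' := mul_right_cancel (b := h) (by rw [e1, mul_assoc, e2,
      mul_one])
    obtain ⟨l, hl⟩ := exists_isLead deg hs0
    have el : g * l = Powers.gen * Powers.gen :=
      (hs ▸ hg.mul deg_injective deg_mul hl).unique deg_injective top_quad
    -- The top coefficient of w₂ times a twist of that of s is the top coefficient 1 of y² - 1.
    have u1 : IsUnit (w₂.coeff g) := by
      refine IsUnit.of_mul_eq_one (g • s.coeff l) ?_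
      rw [← hg.coeff_mul deg_injective deg_mul hl, ← hs, el, hquad]
      have : (1 : Powers) ≠ Powers.gen * Powers.gen :=
        fun e => absurd (congrArg deg e) (by decide)
      classical
      rw [SkewMonoidAlgebra.coeff_sub, Finsupp.sub_apply, coeff_single_apply, coeff_single_apply,
        if_pos rfl, if_neg this, sub_zero]
    have c1 : w₂.coeff g * g • c.coeff h = LaurentPolynomial.invert cubic := by
      rw [← hg.coeff_mul deg_injective deg_mul hh, ← hc, e1, hlin]
      have : (1 : Powers) ≠ Powers.gen := fun e => absurd (congrArg deg e) (by decide)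
      classical
      rw [SkewMonoidAlgebra.coeff_sub, Finsupp.sub_apply, coeff_single_apply, coeff_single_apply,
        if_pos rfl, if_neg this, sub_zero]
    have c2 : w₂.coeff g' * g' • c.coeff h = -cubicTwist := by
      rw [← hg'.coeff_mul neg_deg_injective neg_deg_mul hh', ← hc, e2, hlin]
      have : Powers.gen ≠ (1 : Powers) := fun e => absurd (congrArg deg e) (by decide)
      classical
      rw [SkewMonoidAlgebra.coeff_sub, Finsupp.sub_apply, coeff_single_apply, coeff_single_apply,
        if_pos rfl, if_neg this, zero_sub]
    -- The twists in the top and bottom equations differ by one σ. After σ is applied to the top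
    -- one, both contain the same factor, which therefore divides the cubic and its twist.
    rw [hgg', mul_smul, gen_smul, ← hgg'] at c1
    have c1' := congrArg LaurentPolynomial.invert c1
    rw [map_mul, invert_invert, invert_invert] at c1'
    have hd1 : g' • c.coeff h ∣ cubic := ⟨_, by rw [← c1', mul_comm]⟩
    have hd2 : g' • c.coeff h ∣ cubicTwist :=
      (dvd_neg).1 ⟨_, by rw [← c2, mul_comm]⟩
    refine not_isUnit_cubic ?_
    rw [← c1']
    exact (u1.map LaurentPolynomial.invert).mul (isCoprime_cubic.isUnit_of_dvd' hd1 hd2)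

/-- Left multiplication by `x - 1` is injective. -/
theorem eq_zero_of_x_sub_one_mul {a : SkewLaurent} (h : (x - 1) * a = 0) : a = 0 := by
  by_contra ha
  obtain ⟨g, hg⟩ := exists_isLead deg ha
  have hT : (T 1 - 1 : ℤ[T;T⁻¹]) ≠ 0 := by
    intro h
    -- Evaluation at -1 gives -2; the other unit, 1, is a root of x - 1.
    have h3 := congrArg (eval₂ (Int.castRingHom ℤ) (-1 : ℤˣ)) h
    simp [eval₂_T] at h3
  have hx : x - 1 = coe (T 1 - 1) := by
    rw [coe_sub, coe, coe, single_one_one]; rfl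
  rw [hx] at h
  exact ((isLead_single deg 1 hT).mul deg_injective deg_mul hg).ne_zero h

end SkewLaurent

end FakeKlein

/-! ### Ranks, and kernels of surjections between free modules -/

namespace Module

variable {R M N L : Type*} [Ring R] [AddCommGroup M] [Module R M] [AddCommGroup N] [Module R N]
  [AddCommGroup L] [Module R L]

/-- Over a ring with a homomorphism to the integers, finite bases have the same cardinality. -/
theorem Basis.card_eq_of_ringHom_int {ι κ : Type*} [Fintype ι] [Fintype κ] (ε : R →+* ℤ)
    (b : Basis ι R M) (c : Basis κ R M) : Fintype.card ι = Fintype.card κ := by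
  let _ : Module R ℤ := Module.compHom ℤ ε
  have : SMulCommClass R ℤ ℤ := ⟨fun r m n => mul_left_comm (ε r) m n⟩
  -- With R acting on ℤ through ε, either basis identifies the group of R-linear maps from M to ℤ
  -- with a power of ℤ; the ranks of the two powers agree.
  exact card_eq_of_linearEquiv ℤ ((b.constr ℤ (M' := ℤ)).trans (c.constr ℤ).symm)

/-- A free kernel of a surjection from a module of rank two to a module of rank one is cyclic. -/
theorem exists_generator_ker_of_free (ε : R →+* ℤ) (c : Basis (Fin 2) R N) (l : Basis Unit R L)
    (f : N →ₗ[R] L) (hf : Function.Surjective f) (hfree : Module.Free R (LinearMap.ker f)) :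
    ∃ w : LinearMap.ker f, ∀ v : LinearMap.ker f, ∃ a : R, v = a • w := by
  have : Module.Free R L := Module.Free.of_basis l
  -- A section of the surjection onto a free module makes N the direct sum of the kernel and L.
  obtain ⟨s, hs⟩ := Module.projective_lifting_property f LinearMap.id hf
  have hs' (x : L) : f (s x) = x := LinearMap.congr_fun hs x
  have hbij : Function.Bijective ((LinearMap.ker f).subtype.coprod s) := by
    refine ⟨(injective_iff_map_eq_zero _).2 ?_, fun n => ?_⟩
    · rintro ⟨⟨k, hk⟩, x⟩ h
      have hk' : f k = 0 := hk
      have h' : k + s x = 0 := h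
      have hx : x = 0 := by
        have := congrArg f h'
        rwa [map_add, hk', hs', zero_add, map_zero] at this
      subst hx
      rw [map_zero, add_zero] at h'
      subst h'
      rfl
    · refine ⟨(⟨n - s (f n), ?_⟩, f n), ?_⟩
      · rw [LinearMap.mem_ker, map_sub, hs', sub_self]
      · exact sub_add_cancel n (s (f n))
  let e := LinearEquiv.ofBijective _ hbij
  have : Module.Finite R N := Module.Finite.of_basis c
  have : Module.Finite R (LinearMap.ker f) :=
    Module.Finite.of_surjective (LinearMap.fst R (LinearMap.ker f) L ∘ₗ (e.symm : N →ₗ[R] _))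
      (Prod.fst_surjective.comp e.symm.surjective)
  let b := Module.Free.chooseBasis R (LinearMap.ker f)
  have hε : Nontrivial R := ε.domain_nontrivial
  have hfin : Finite (Module.Free.ChooseBasisIndex R (LinearMap.ker f)) :=
    Module.Finite.finite_basis b
  have := Fintype.ofFinite (Module.Free.ChooseBasisIndex R (LinearMap.ker f))
  -- The basis of the kernel together with the one of L has two elements, so the kernel has rank
  -- one.
  have hcard := ((b.prod l).map e).card_eq_of_ringHom_int ε c
  rw [Fintype.card_sum, Fintype.card_unit, Fintype.card_fin] at hcard
  obtain ⟨i, hi⟩ := Fintype.card_eq_one_iff.1 (Nat.succ.inj hcard)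
  refine ⟨b i, fun v => ⟨b.repr v i, ?_⟩⟩
  conv_lhs => rw [← b.sum_repr v]
  exact Finset.sum_eq_single i (fun j _ hj => absurd (hi j) hj)
    fun h => absurd (Finset.mem_univ i) h

end Module

/-! ### Surjectivity of ψ and non-freeness of its kernel, over the group ring -/

namespace FakeKlein

open scoped LaurentPolynomial
open LaurentPolynomial

theorem coe_cubic_eq : SkewLaurent.coe cubic = SkewLaurent.x ^ 3 - SkewLaurent.x - 1 := by
  have key {A B : Type} [Ring A] [Ring B] (φ : A →+* B) (a : A) :
      φ (a ^ 3 - a - 1) = φ a ^ 3 - φ a - 1 := by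
    rw [map_sub, map_sub, map_pow, map_one]
  exact key (SkewMonoidAlgebra.singleOneRingHom : ℤ[T;T⁻¹] →+* SkewLaurent) (T 1)

theorem skewEquiv_psi (w : ZK × ZK) :
    skewEquiv (psi w) = SkewLaurent.row (skewEquiv w.1) (skewEquiv w.2) := by
  have key {A B : Type} [Ring A] [Ring B] (φ : A ≃+* B) (a b c u v : A) :
      φ ((a - b) * u + (c ^ 3 - c - 1) * v) =
        (φ a - φ b) * φ u + (φ c ^ 3 - φ c - 1) * φ v := by
    simp only [map_add, map_sub, map_mul, map_pow, map_one]
  refine (key skewEquiv (el gy) (el gx⁻¹) (el gx) w.1 w.2).trans ?_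
  rw [skewEquiv_el_gx, skewEquiv_el_gy, skewEquiv_el_gx_inv, SkewLaurent.row, coe_cubic_eq]

theorem psi_surjective : Function.Surjective psi := by
  intro s
  obtain ⟨u, v, h⟩ := SkewLaurent.exists_row_eq_one
  refine ⟨(skewEquiv.symm (u * skewEquiv s), skewEquiv.symm (v * skewEquiv s)),
    skewEquiv.injective ?_⟩
  rw [skewEquiv_psi, RingEquiv.apply_symm_apply, RingEquiv.apply_symm_apply, SkewLaurent.row_mul,
    h, one_mul]

/-- The augmentation of the opposite of the group ring. -/
noncomputable def augmentation : ZKᵐᵒᵖ →+* ℤ :=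
  (MonoidAlgebra.lift ℤ ℤ P.Group 1 : ZK →+* ℤ).fromOpposite fun _ _ => mul_comm _ _

/-- The group ring as a free right module of rank one over itself. -/
noncomputable def opEquiv : ZKᵐᵒᵖ ≃ₗ[ZKᵐᵒᵖ] ZK where
  __ := MulOpposite.opAddEquiv.symm
  map_smul' _ _ := rfl

theorem not_free_ker_psi : ¬ Module.Free ZKᵐᵒᵖ (LinearMap.ker psi) := by
  intro hfree
  obtain ⟨⟨w, hw⟩, hgen⟩ := Module.exists_generator_ker_of_free augmentation
    ((Module.Basis.finTwoProd ZKᵐᵒᵖ).map (opEquiv.prodCongr opEquiv))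
    ((Module.Basis.singleton Unit ZKᵐᵒᵖ).map opEquiv) psi psi_surjective hfree
  refine SkewLaurent.not_principal (skewEquiv w.1) (skewEquiv w.2) ?_ fun u v huv => ?_
  · rw [← skewEquiv_psi, LinearMap.mem_ker.1 hw, map_zero]
  · have hmem : (skewEquiv.symm u, skewEquiv.symm v) ∈ LinearMap.ker psi := by
      rw [LinearMap.mem_ker]
      apply skewEquiv.injective
      rw [skewEquiv_psi, map_zero, RingEquiv.apply_symm_apply, RingEquiv.apply_symm_apply, huv]
    obtain ⟨a, ha⟩ := hgen ⟨_, hmem⟩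
    have h2 : skewEquiv.symm v = w.2 * a.unop :=
      congrArg (fun k : LinearMap.ker psi => (k : ZK × ZK).2) ha
    exact ⟨skewEquiv a.unop, by rw [← map_mul, ← h2, RingEquiv.apply_symm_apply]⟩

/-- This amounts to the vanishing of the second homology of the universal cover of K: x - 1 is one
entry of its boundary map. -/
theorem eq_zero_of_el_gx_sub_one_mul {a : ZK} (h : (el gx - 1) * a = 0) : a = 0 := by
  apply skewEquiv.injective
  rw [map_zero]
  apply SkewLaurent.eq_zero_of_x_sub_one_mul
  rw [← skewEquiv_el_gx, ← map_one skewEquiv, ← map_sub, ← map_mul, h, map_zero]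

end FakeKlein

/-! ### The cellular boundary of the universal cover of X_Q -/

namespace FakeKlein

open Letter

theorem ringEquiv_el (g : P.Group) : ringEquiv (el g) = MonoidAlgebra.single (groupEquiv g) 1 := by
  simp [ringEquiv, el]

/-- The element of the group ring of `Q` given by an element of the group. -/
noncomputable abbrev elQ (g : Q.Group) : MonoidAlgebra ℤ Q.Group := MonoidAlgebra.single g 1

/-- The image of `psi` in the group ring of `Q`. -/
theorem ringEquiv_psi (w : ZK × ZK) : ringEquiv (psi w) =
    (elQ qy - elQ qx⁻¹) * ringEquiv w.1 + (elQ qx ^ 3 - elQ qx - 1) * ringEquiv w.2 := by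
  change ringEquiv ((el gy - el gx⁻¹) * w.1 + (el gx ^ 3 - el gx - 1) * w.2) = _
  rw [map_add, map_mul, map_mul, map_sub, map_sub, map_sub, map_pow, map_one, ringEquiv_el,
    ringEquiv_el, ringEquiv_el, map_inv, groupEquiv_gx, groupEquiv_gy]

/-- The 1-chain over one loop with given coefficients. -/
noncomputable def chain₁ (l : Q.Gen) : MonoidAlgebra ℤ Q.Group →+ cover.total.C₁ where
  toFun a := a.coeff.mapDomain fun g => ((g, l) : Q.Group × Q.Gen)
  map_zero' := Finsupp.mapDomain_zero
  map_add' _ _ := Finsupp.mapDomain_add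

/-- The 2-chain over one disk with given coefficients. -/
noncomputable def chain₂ (r : Q.Rel) : MonoidAlgebra ℤ Q.Group →+ cover.total.C₂ where
  toFun a := a.coeff.mapDomain fun g => ((g, r) : Q.Group × Q.Rel)
  map_zero' := Finsupp.mapDomain_zero
  map_add' _ _ := Finsupp.mapDomain_add

theorem chain₁_single (l : Q.Gen) (g : Q.Group) (n : ℤ) :
    chain₁ l (MonoidAlgebra.single g n) = Finsupp.single ((g, l) : Q.Group × Q.Gen) n :=
  Finsupp.mapDomain_single

theorem chain₂_single (r : Q.Rel) (g : Q.Group) (n : ℤ) :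
    chain₂ r (MonoidAlgebra.single g n) = Finsupp.single ((g, r) : Q.Group × Q.Rel) n :=
  Finsupp.mapDomain_single

theorem chain₁_apply_same (l : Q.Gen) (a : MonoidAlgebra ℤ Q.Group) (g : Q.Group) :
    (chain₁ l a : Q.Group × Q.Gen →₀ ℤ) (g, l) = a.coeff g :=
  Finsupp.mapDomain_apply (fun _ _ h => congrArg Prod.fst h) _ g

theorem chain₁_apply_ne {l m : Q.Gen} (h : l ≠ m) (a : MonoidAlgebra ℤ Q.Group) (g : Q.Group) :
    (chain₁ l a : Q.Group × Q.Gen →₀ ℤ) (g, m) = 0 :=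
  Finsupp.mapDomain_of_notMem_range _ _ fun ⟨_, hk⟩ => h (congrArg Prod.snd hk)

theorem chain₂_apply_same (r : Q.Rel) (a : MonoidAlgebra ℤ Q.Group) (g : Q.Group) :
    (chain₂ r a : Q.Group × Q.Rel →₀ ℤ) (g, r) = a.coeff g :=
  Finsupp.mapDomain_apply (fun _ _ h => congrArg Prod.fst h) _ g

theorem chain₂_apply_ne {r s : Q.Rel} (h : r ≠ s) (a : MonoidAlgebra ℤ Q.Group) (g : Q.Group) :
    (chain₂ r a : Q.Group × Q.Rel →₀ ℤ) (g, s) = 0 :=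
  Finsupp.mapDomain_of_notMem_range _ _ fun ⟨_, hk⟩ => h (congrArg Prod.snd hk)

theorem op_smul_cell (a : ZK) (r : Q.Rel) :
    MulOpposite.op a • cell r = chain₂ r (ringEquiv a) := by
  change (MulOpposite.op (ringEquiv a) : (MonoidAlgebra ℤ Q.Group)ᵐᵒᵖ) •
    (cell r : Q.universalCover.total.C₂) = _
  generalize ringEquiv a = b
  induction b using MonoidAlgebra.induction_linear with
  | zero => rw [MulOpposite.op_zero, zero_smul, map_zero]
  | add b c hb hc => rw [MulOpposite.op_add, add_smul, hb, hc, map_add]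
  | single g n =>
    rw [GroupPresentation.op_single_smul, chain₂_single]
    have h : (Q.deck g).mapC₂ (cell r) = Finsupp.single ((g, r) : Q.Group × Q.Rel) 1 :=
      (Finsupp.mapDomain_single (f := (Q.deck g).onFace)
        (a := ((1, r) : Q.Group × Q.Rel)) (b := (1 : ℤ))).trans
        (congrArg (fun k => Finsupp.single ((k, r) : Q.Group × Q.Rel) (1 : ℤ)) (one_mul g))
    rw [h]
    refine (Finsupp.smul_single n _ 1).trans ?_
    rw [smul_eq_mul, mul_one]

theorem qx_mul_qy : qx * qy = qy * qx⁻¹ := by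
  have h : qy⁻¹ * qx * qy = qx⁻¹ := eq_inv_of_mul_eq_one_left (rel_of_rels rel_Q₁ rel_Q₂)
  rw [← h]; group

/-- A rewriting rule that moves y to the left of x; with its companion for x⁻¹ it brings the
vertices along a lifted relator to a normal form. -/
theorem qx_mul_qy_mul (g : Q.Group) : qx * (qy * g) = qy * (qx⁻¹ * g) := by
  rw [← mul_assoc, qx_mul_qy, mul_assoc]

theorem qx_inv_mul_qy_mul (g : Q.Group) : qx⁻¹ * (qy * g) = qy * (qx * g) := by
  rw [inv_mul_eq_iff_eq_mul, qx_mul_qy_mul, inv_mul_cancel_left]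

theorem d₂_single (g : Q.Group) (r : Q.Rel) (n : ℤ) :
    cover.total.d₂ (Finsupp.single ((g, r) : Q.Group × Q.Rel) n) =
      n • ((Q.lift g (Q.word r).reverse).map Q.coverComplex.stepChain).sum :=
  Finsupp.linearCombination_single _ _ _

/-- The 1-chain of a step of the universal cover. -/
noncomputable def edgeChain (g : Q.Group) (l : Letter) (b : Bool) : cover.total.C₁ :=
  Q.coverComplex.stepChain ((g, l), b)

theorem edgeChain_true (g : Q.Group) (l : Letter) : edgeChain g l true = chain₁ l (elQ g) :=
  (chain₁_single l g 1).symm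

theorem edgeChain_false (g : Q.Group) (l : Letter) : edgeChain g l false = -chain₁ l (elQ g) :=
  (Finsupp.single_neg _ _).trans (congrArg Neg.neg (chain₁_single l g 1).symm)

/-- The relator is traversed from its last letter to its first. An edge traversed backwards is
recorded at its initial vertex, where that step ends. -/
theorem sum_lift_rel₁ (g : Q.Group) :
    ((Q.lift g (Q.word rel₁).reverse).map Q.coverComplex.stepChain).sum =
      edgeChain (qx⁻¹ * g) x false +
      (edgeChain (qx⁻¹ * g) y true +
      (edgeChain (qy * (qx⁻¹ * g)) y true +
      (edgeChain (qy * (qy * (qx⁻¹ * g))) x true +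
      (edgeChain (qy⁻¹ * (qx * (qy * (qy * (qx⁻¹ * g))))) y false +
      (edgeChain (qy⁻¹ * (qy⁻¹ * (qx * (qy * (qy * (qx⁻¹ * g)))))) y false + 0))))) := rfl

theorem sum_lift_rel₂ (g : Q.Group) :
    ((Q.lift g (Q.word rel₂).reverse).map Q.coverComplex.stepChain).sum =
      edgeChain g y true +
      (edgeChain (qx⁻¹ * (qy * g)) x false +
      (edgeChain (qx⁻¹ * (qx⁻¹ * (qy * g))) x false +
      (edgeChain (qy⁻¹ * (qx⁻¹ * (qx⁻¹ * (qy * g)))) y false +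
      (edgeChain (qy⁻¹ * (qx⁻¹ * (qx⁻¹ * (qy * g)))) x true +
      (edgeChain (qx * (qy⁻¹ * (qx⁻¹ * (qx⁻¹ * (qy * g))))) x true +
      (edgeChain (qx * (qx * (qy⁻¹ * (qx⁻¹ * (qx⁻¹ * (qy * g)))))) y true +
      (edgeChain (qy * (qx * (qx * (qy⁻¹ * (qx⁻¹ * (qx⁻¹ * (qy * g))))))) x true +
      (edgeChain (qy⁻¹ * (qx * (qy * (qx * (qx * (qy⁻¹ * (qx⁻¹ * (qx⁻¹ * (qy * g))))))))) y false +
      (edgeChain (qx⁻¹ * (qy⁻¹ * (qx * (qy * (qx * (qx * (qy⁻¹ * (qx⁻¹ * (qx⁻¹ * (qy * g))))))))))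
        x false +
      (edgeChain (qx⁻¹ * (qx⁻¹ * (qy⁻¹ * (qx * (qy * (qx * (qx * (qy⁻¹ * (qx⁻¹ * (qx⁻¹ * (qy *
        g))))))))))) x false +
      (edgeChain (qx⁻¹ * (qx⁻¹ * (qx⁻¹ * (qy⁻¹ * (qx * (qy * (qx * (qx * (qy⁻¹ * (qx⁻¹ * (qx⁻¹ *
        (qy * g)))))))))))) x false + 0))))))))))) := rfl

/-- The boundary of the first disk. -/
theorem d₂_chain₂_rel₁ (a : MonoidAlgebra ℤ Q.Group) : cover.total.d₂ (chain₂ rel₁ a) =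
    chain₁ x ((1 + elQ (qy * qx)) * ((elQ qy - elQ qx⁻¹) * a)) +
      chain₁ y ((elQ qx - 1) * ((elQ qy - elQ qx⁻¹) * a)) := by
  induction a using MonoidAlgebra.induction_linear with
  | zero => simp only [map_zero, mul_zero, add_zero]
  | add b c hb hc =>
    simp only [map_add, mul_add, hb, hc]
    abel
  | single g n =>
    have hn : MonoidAlgebra.single g n = n • elQ g := by simp [elQ]
    rw [chain₂_single, d₂_single, sum_lift_rel₁, hn]
    simp only [mul_smul_comm, map_zsmul, ← smul_add]
    congr 1
    -- In normal form the y-part is yx⁻¹ + x⁻¹ - y - 1 = (x - 1)(y - x⁻¹) and the x-part is y²x⁻¹ -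
    -- x⁻¹ = (1 + yx)(y - x⁻¹), each applied to g.
    simp only [edgeChain_true, edgeChain_false, add_mul, sub_mul, mul_sub, one_mul, elQ,
      MonoidAlgebra.single_mul_single,
      mul_assoc, mul_one, map_add, map_sub, qx_mul_qy_mul, qx_inv_mul_qy_mul,
      mul_inv_cancel_left, inv_mul_cancel_left]
    abel

/-- The boundary of the second disk. -/
theorem d₂_chain₂_rel₂ (a : MonoidAlgebra ℤ Q.Group) : cover.total.d₂ (chain₂ rel₂ a) =
    chain₁ x ((1 + elQ (qy * qx)) * ((elQ qx ^ 3 - elQ qx - 1) * a)) +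
      chain₁ y ((elQ qx - 1) * ((elQ qx ^ 3 - elQ qx - 1) * a)) := by
  induction a using MonoidAlgebra.induction_linear with
  | zero => simp only [map_zero, mul_zero, add_zero]
  | add b c hb hc =>
    simp only [map_add, mul_add, hb, hc]
    abel
  | single g n =>
    have hn : MonoidAlgebra.single g n = n • elQ g := by simp [elQ]
    rw [chain₂_single, d₂_single, sum_lift_rel₂, hn]
    simp only [mul_smul_comm, map_zsmul, ← smul_add]
    congr 1
    simp only [edgeChain_true, edgeChain_false, add_mul, sub_mul, mul_sub, one_mul, elQ,
      MonoidAlgebra.single_mul_single,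
      mul_assoc, mul_one, map_add, map_sub, qx_mul_qy_mul, qx_inv_mul_qy_mul,
      inv_mul_cancel_left, pow_succ, pow_zero]
    abel

/-- The 2-chain with given coefficients in the group ring of `P`. -/
noncomputable def chainMap : (ZK × ZK) →ₗ[ZKᵐᵒᵖ] cover.total.C₂ where
  toFun w := MulOpposite.op w.1 • cell rel₁ + MulOpposite.op w.2 • cell rel₂
  map_add' w w' := by
    simp only [Prod.fst_add, Prod.snd_add, MulOpposite.op_add, add_smul]
    abel
  map_smul' a w := by
    obtain ⟨a, rfl⟩ := MulOpposite.op_surjective a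
    simp only [Prod.smul_fst, Prod.smul_snd, MulOpposite.smul_eq_mul_unop, MulOpposite.unop_op,
      MulOpposite.op_mul, mul_smul, smul_add, RingHom.id_apply]

theorem chainMap_apply (w : ZK × ZK) :
    chainMap w = chain₂ rel₁ (ringEquiv w.1) + chain₂ rel₂ (ringEquiv w.2) := by
  rw [← op_smul_cell, ← op_smul_cell]; rfl

theorem rel₁_ne_rel₂ : rel₁ ≠ rel₂ := by
  intro h
  exact absurd (show (0 : Fin 2) = 1 from h) (by decide)

theorem chainMap_bijective : Function.Bijective chainMap := by
  refine ⟨(injective_iff_map_eq_zero _).2 fun w hw => ?_, fun c => ?_⟩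
  · rw [chainMap_apply] at hw
    have h1 : ringEquiv w.1 = 0 := by
      ext g
      have := DFunLike.congr_fun hw ((g, rel₁) : Q.Group × Q.Rel)
      rw [Finsupp.add_apply, chain₂_apply_same, chain₂_apply_ne rel₁_ne_rel₂.symm, add_zero] at this
      exact this
    have h2 : ringEquiv w.2 = 0 := by
      ext g
      have := DFunLike.congr_fun hw ((g, rel₂) : Q.Group × Q.Rel)
      rw [Finsupp.add_apply, chain₂_apply_same, chain₂_apply_ne rel₁_ne_rel₂, zero_add] at this
      exact this
    exact Prod.ext ((map_eq_zero_iff _ ringEquiv.injective).1 h1)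
      ((map_eq_zero_iff _ ringEquiv.injective).1 h2)
  · induction c using Finsupp.induction_linear with
    | zero => exact ⟨0, map_zero _⟩
    | add b c hb hc =>
      obtain ⟨u, rfl⟩ := hb
      obtain ⟨v, rfl⟩ := hc
      exact ⟨u + v, map_add _ _ _⟩
    | single f n =>
      obtain ⟨g, r⟩ := f
      have hr : r = rel₁ ∨ r = rel₂ := by
        change Fin 2 at r
        fin_cases r
        · exact Or.inl rfl
        · exact Or.inr rfl
      rcases hr with rfl | rfl
      · refine ⟨(ringEquiv.symm (MonoidAlgebra.single g n), 0), ?_⟩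
        rw [chainMap_apply, RingEquiv.apply_symm_apply, map_zero, map_zero, add_zero,
          chain₂_single]
      · refine ⟨(0, ringEquiv.symm (MonoidAlgebra.single g n)), ?_⟩
        rw [chainMap_apply, RingEquiv.apply_symm_apply, map_zero, map_zero, zero_add,
          chain₂_single]

/-- The left factors 1 + yx and x - 1 are the Fox derivatives of y⁻¹xyx, read from right to left.
Hence ψ records how each disk of X_Q is expressed by translates of the single disk of K. -/
theorem d₂_chainMap (w : ZK × ZK) : cover.total.d₂ (chainMap w) =
    chain₁ x ((1 + elQ (qy * qx)) * ringEquiv (psi w)) +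
      chain₁ y ((elQ qx - 1) * ringEquiv (psi w)) := by
  rw [chainMap_apply, map_add, d₂_chain₂_rel₁, d₂_chain₂_rel₂, ringEquiv_psi]
  simp only [mul_add, map_add]
  abel

theorem chainMap_mem_H₂_iff (w : ZK × ZK) : chainMap w ∈ H₂ ↔ w ∈ LinearMap.ker psi := by
  rw [LinearMap.mem_ker]
  constructor
  · intro h
    have h0 : cover.total.d₂ (chainMap w) = 0 := h
    rw [d₂_chainMap] at h0
    -- The coefficients on the y-edges alone suffice, because x - 1 is left regular.
    have hy : (elQ qx - 1) * ringEquiv (psi w) = 0 := by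
      ext g
      have := DFunLike.congr_fun h0 ((g, y) : Q.Group × Q.Gen)
      rw [Finsupp.add_apply, chain₁_apply_same (l := y), chain₁_apply_ne (l := x) (m := y)
        (fun e : x = y => by cases e), zero_add] at this
      exact this
    apply eq_zero_of_el_gx_sub_one_mul
    apply ringEquiv.injective
    rw [map_mul, map_sub, map_one, ringEquiv_el, groupEquiv_gx, hy, map_zero]
  · intro h
    change cover.total.d₂ (chainMap w) = 0
    rw [d₂_chainMap, h, map_zero, mul_zero, mul_zero, map_zero, map_zero, add_zero]

/-- The second homology of the universal cover of `X_Q` is the kernel of `psi`. -/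
noncomputable def homologyEquiv : H₂ ≃ₗ[ZKᵐᵒᵖ] LinearMap.ker psi :=
  (LinearEquiv.ofBijective chainMap chainMap_bijective).symm.ofSubmodules H₂
      (LinearMap.ker psi) <| by
    ext w
    rw [Submodule.mem_map_equiv, LinearEquiv.symm_symm]
    exact chainMap_mem_H₂_iff w

theorem chainMap_homologyEquiv (z : H₂) : chainMap (homologyEquiv z) = z :=
  (LinearEquiv.ofBijective chainMap chainMap_bijective).apply_symm_apply (z : cover.total.C₂)

end FakeKlein

theorem theorem3 :
    (∃ Θ : FakeKlein.ZK ≃+* FakeKlein.SkewLaurent,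
      Θ (FakeKlein.el FakeKlein.gx) = FakeKlein.SkewLaurent.x ∧
      Θ (FakeKlein.el FakeKlein.gy) = FakeKlein.SkewLaurent.y) ∧
    Function.Surjective FakeKlein.psi ∧
    (∃ e : FakeKlein.H₂ ≃ₗ[FakeKlein.ZKᵐᵒᵖ] LinearMap.ker FakeKlein.psi,
      ∀ z : FakeKlein.H₂, (z : FakeKlein.cover.total.C₂) =
        MulOpposite.op (e z : FakeKlein.ZK × FakeKlein.ZK).1 • FakeKlein.cell FakeKlein.rel₁ +
        MulOpposite.op (e z : FakeKlein.ZK × FakeKlein.ZK).2 • FakeKlein.cell FakeKlein.rel₂) ∧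
    ¬ Module.Free FakeKlein.ZKᵐᵒᵖ FakeKlein.H₂ :=
  ⟨⟨FakeKlein.skewEquiv, FakeKlein.skewEquiv_el_gx, FakeKlein.skewEquiv_el_gy⟩,
    FakeKlein.psi_surjective,
    ⟨FakeKlein.homologyEquiv, fun z => (FakeKlein.chainMap_homologyEquiv z).symm⟩,
    fun _ => FakeKlein.not_free_ker_psi (Module.Free.of_equiv FakeKlein.homologyEquiv)⟩
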